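/- **Interaction systems.** An interaction system $w$ consists of a set of states $S$, for each $s\in S$ a set $A(s)$ of actions, for each $a\in A(s)$ a set $D(s,a)$ of reactions, and for each $d\in D(s,a)$ a next state $s[a/d]\in S$. A relation $r\subseteq S_1\times S_2$ is a simulation from $w_1$ to $w_2$ if for all $(s_1,s_2)\in r$: for every $a_1\in A_1(s_1)$ there is $a_2\in A_2(s_2)$ such that for every $d_2\in D_2(s_2,a_2)$ there is $d_1\in D_1(s_1,a_1)$ with $(s_1[a_1/d_1],s_2[a_2/d_2])\in r$. - $\mathbf 1$ has one state, one action, one reaction. - $w_1\otimes w_2$ has states $S_1\times S_2$, and pairs of actions, of reactions and of next states, componentwise. - $w_1\multimap w_2$ has states $S_1\times S_2$; an action in $(s_1,s_2)$ is a pair $(f,G)$ with $f:A_1(s_1)\to A_2(s_2)$ and $G_{a}:D_2(s_2,f(a))\to D_1(s_1,a)$ for each $a\in A_1(s_1)$; a reaction to $(f,G)$ is a pair $(a,d)$ with $a\in A_1(s_1)$, $d\in D_2(s_2,f(a))$; the next state is $(s_1[a/G_a(d)],\,s_2[f(a)/d])$. - $!w$ has as states the finite multisets over $S$; an action in $\mu$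 is an enumeration $(s_1,\dots,s_n)$ of $\mu$ with a tuple $(a_1,\dots,a_n)$, $a_i\in A(s_i)$; a reaction is a tuple $(d_1,\dots,d_n)$, $d_i\in D(s_i,a_i)$; the next state is the multiset $[s_1[a_1/d_1],\dots,s_n[a_n/d_n]]$. **Calculus.** Simple types are generated from atoms by $\to$. Terms, up to renaming of bound variables, are $$t,u ::= x \mid (t)u \mid \lambda x.t \mid 0 \mid t+u \mid \mathrm D t\cdot u .$$ Typing $\Gamma\vdash t:\sigma$ is given by the usual rules for variables, abstraction and application, together with: $\Gamma\vdash 0:\sigma$ for every $\sigma$; if $\Gamma\vdash t_1:\sigma$ and $\Gamma\vdash t_2:\sigma$ then $\Gamma\vdash t_1+t_2:\sigma$; if $\Gamma\vdash t:\tau\to\sigma$ and $\Gamma\vdash u:\tau$ then $\Gamma\vdash \mathrm D t\cdot u:\tau\to\sigma$. Capture-avoiding substitution $t[u/x]$ is as usual and commutes with $0$, $+$ and $\mathrm D$. Linear substitution is defined by $$\tfrac{\partial x}{\partial x}\cdot u=u,\qquad \tfrac{\partial y}{\partial x}\cdot u=0\ (y\ne x),\qquad \tfrac{\partial 0}{\partial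 x}\cdot u=0,\qquad \tfrac{\partial (t_1+t_2)}{\partial x}\cdot u=\tfrac{\partial t_1}{\partial x}\cdot u+\tfrac{\partial t_2}{\partial x}\cdot u,$$ $$\tfrac{\partial (t)v}{\partial x}\cdot u=\big(\tfrac{\partial t}{\partial x}\cdot u\big)v+\big(\mathrm D t\cdot(\tfrac{\partial v}{\partial x}\cdot u)\big)v,\qquad \tfrac{\partial (\mathrm D t\cdot v)}{\partial x}\cdot u=\mathrm D\big(\tfrac{\partial t}{\partial x}\cdot u\big)\cdot v+\mathrm D t\cdot\big(\tfrac{\partial v}{\partial x}\cdot u\big),$$ $$\tfrac{\partial (\lambda y.t)}{\partial x}\cdot u=\lambda y.\big(\tfrac{\partial t}{\partial x}\cdot u\big)\quad(y\neq x,\ y\text{ not free in }u).$$ **Interpretation.** Fix an arbitrary assignment of interaction systems to the atoms. Types are interpreted by $\tau\to\sigma\mapsto\, !\tau\multimap\sigma$, and for a context $\Gamma=x_1:\tau_1,\dots,x_n:\tau_n$ let $!\Gamma=\,!\tau_1\otimes\dots\otimes!\tau_n$ (with $!\Gamma=\mathbf 1$ if $n=0$). A state $\gamma$ of $!\Gamma$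 is thus a tuple of multisets $\gamma(x_i)$ of states of $\tau_i$; such tuples are added componentwise. The relational interpretation $[[t]]$ of a derivation of $\Gamma\vdash t:\sigma$, a relation between states of $!\Gamma$ and states of $\sigma$, is defined by induction on the derivation: - $(\gamma,s)\in[[x]]$ iff $\gamma(x)=[s]$ and $\gamma(y)=[\,]$ for all $y\neq x$; - $(\gamma,(\mu,s))\in[[\lambda x.t]]$ iff $(\gamma_{x:=\mu},s)\in[[t]]$; - $(\gamma,s)\in[[(t)u]]$ iff there are $n\ge 0$, $\gamma_0,\dots,\gamma_n$ and $s_1,\dots,s_n$ with $(\gamma_0,([s_1,\dots,s_n],s))\in[[t]]$, $(\gamma_i,s_i)\in[[u]]$ for $1\le i\le n$, and $\gamma=\gamma_0+\dots+\gamma_n$; - $[[0]]=\emptyset$ and $[[t_1+t_2]]=[[t_1]]\cup[[t_2]]$; - $(\gamma,(\mu,s'))\in[[\mathrm D t\cdot u]]$ iff there are $\gamma_1,\gamma_2,s$ with $\gamma=\gamma_1+\gamma_2$, $(\gamma_1,(\mu+[s],s'))\in[[t]]$ and $(\gamma_2,s)\in[[u]]$. **Proposition.** 1. For every derivation of $\Gamma\vdash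 t:\sigma$, the relation $[[t]]$ is a simulation from $!\Gamma$ to $\sigma$. 2. If $\Gamma\vdash(\lambda x.t)u:\sigma$, then $\Gamma\vdash t[u/x]:\sigma$ and $$[[(\lambda x.t)u]]=[[t[u/x]]].$$ 3. If $\Gamma\vdash \mathrm D(\lambda x.t)\cdot u:\sigma$, where $x$ is not free in $u$, then $\Gamma\vdash\lambda x.\big(\tfrac{\partial t}{\partial x}\cdot u\big):\sigma$ and $$[[\mathrm D(\lambda x.t)\cdot u]]=\Big[\Big[\lambda x.\big(\tfrac{\partial t}{\partial x}\cdot u\big)\Big]\Big].$$ In 2 and 3 the equality holds for all derivations of the two typing judgements. -/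

import Mathlib

universe u v

namespace DiffLambda

/-- An interaction system: states, actions, reactions and next state. -/
structure IntSystem : Type (u + 1) where
  State : Type u
  Act : State → Type u
  React : (s : State) → Act s → Type u
  next : (s : State) → (a : Act s) → React s a → State

/-- Simulation relations between two interaction systems. -/
def IsSimulation (w₁ w₂ : IntSystem.{u}) (r : Set (w₁.State × w₂.State)) : Prop :=
  ∀ s₁ s₂, (s₁, s₂) ∈ r →
    ∀ a₁ : w₁.Act s₁, ∃ a₂ : w₂.Act s₂, ∀ d₂ : w₂.React s₂ a₂, ∃ d₁ : w₁.React s₁ a₁,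
      (w₁.next s₁ a₁ d₁, w₂.next s₂ a₂ d₂) ∈ r

namespace IntSystem

/-- The system without interaction. -/
def one : IntSystem.{u} where
  State := PUnit
  Act _ := PUnit
  React _ _ := PUnit
  next _ _ _ := PUnit.unit

/-- Synchronous product. -/
def tensor (w₁ w₂ : IntSystem.{u}) : IntSystem.{u} where
  State := w₁.State × w₂.State
  Act s := w₁.Act s.1 × w₂.Act s.2
  React s a := w₁.React s.1 a.1 × w₂.React s.2 a.2
  next s a d := (w₁.next s.1 a.1 d.1, w₂.next s.2 a.2 d.2)

/-- Linear arrow. -/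
def lolli (w₁ w₂ : IntSystem.{u}) : IntSystem.{u} where
  State := w₁.State × w₂.State
  Act s := Σ f : w₁.Act s.1 → w₂.Act s.2,
    (a₁ : w₁.Act s.1) → w₂.React s.2 (f a₁) → w₁.React s.1 a₁
  React s F := Σ a₁ : w₁.Act s.1, w₂.React s.2 (F.1 a₁)
  next s F p := (w₁.next s.1 p.1 (F.2 p.1 p.2), w₂.next s.2 (F.1 p.1) p.2)

/-- Actions of the multithreaded system: `A(s₁) × ... × A(sₙ)`. -/
def ListAct (w : IntSystem.{u}) : List w.State → Type u
  | [] => PUnit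
  | s :: l => w.Act s × ListAct w l

/-- Reactions of the multithreaded system: `D(s₁,a₁) × ... × D(sₙ,aₙ)`. -/
def ListReact (w : IntSystem.{u}) : (l : List w.State) → w.ListAct l → Type u
  | [], _ => PUnit
  | s :: l, a => w.React s a.1 × ListReact w l a.2

/-- Next state of the multithreaded system: `(s₁[a₁/d₁], ..., sₙ[aₙ/dₙ])`. -/
def listNext (w : IntSystem.{u}) :
    (l : List w.State) → (a : w.ListAct l) → w.ListReact l a → List w.State
  | [], _, _ => []
  | s :: l, a, d => w.next s a.1 d.1 :: listNext w l a.2 d.2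

/-- Synchronous multithreading up to permutation, on finite multisets of states. An action first
chooses an enumeration of the multiset. -/
def bang (w : IntSystem.{u}) : IntSystem.{u} where
  State := Multiset w.State
  Act μ := Σ l : {l : List w.State // (l : Multiset w.State) = μ}, w.ListAct l.1
  React _ a := w.ListReact a.1.1 a.2
  next _ a d := (w.listNext a.1.1 a.2 d : Multiset w.State)

end IntSystem

/-- Raw terms of the differential lambda-calculus, up to renaming of bound variables
(de Bruijn indices). `diff t u` is the term `D t · u`. -/
inductive Tm : Type
  | var : ℕ → Tm
  | app : Tm → Tm → Tm
  | lam : Tm → Tm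
  | zero : Tm
  | sum : Tm → Tm → Tm
  | diff : Tm → Tm → Tm

namespace Tm

/-- Extension of a renaming of variables under a binder. -/
def upRen (ρ : ℕ → ℕ) : ℕ → ℕ
  | 0 => 0
  | n + 1 => ρ n + 1

/-- Renaming of the free variables. -/
def rename : (ℕ → ℕ) → Tm → Tm
  | ρ, var n => var (ρ n)
  | ρ, app t v => app (rename ρ t) (rename ρ v)
  | ρ, lam t => lam (rename (upRen ρ) t)
  | _, zero => zero
  | ρ, sum t₁ t₂ => sum (rename ρ t₁) (rename ρ t₂)
  | ρ, diff t v => diff (rename ρ t) (rename ρ v)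

/-- The term `t` seen under one more binder. -/
def shift (t : Tm) : Tm := rename Nat.succ t

/-- Extension of a substitution under a binder. -/
def upSub (θ : ℕ → Tm) : ℕ → Tm
  | 0 => var 0
  | n + 1 => shift (θ n)

/-- Simultaneous capture-avoiding substitution. -/
def subst : (ℕ → Tm) → Tm → Tm
  | θ, var n => θ n
  | θ, app t v => app (subst θ t) (subst θ v)
  | θ, lam t => lam (subst (upSub θ) t)
  | _, zero => zero
  | θ, sum t₁ t₂ => sum (subst θ t₁) (subst θ t₂)
  | θ, diff t v => diff (subst θ t) (subst θ v)

/-- `inst u t` is `t[u/x]`, where `x` is the variable with index `0`, which disappears. -/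
def inst (u t : Tm) : Tm :=
  subst (fun n => match n with
    | 0 => u
    | m + 1 => var m) t

/-- `linSubst k u t` is the linear substitution `(∂t/∂x)·u`, where `x` is the variable with
index `k`. The variable `x` may still occur in the result. -/
def linSubst : ℕ → Tm → Tm → Tm
  | k, u, var n => if n = k then u else zero
  | k, u, app t v =>
      sum (app (linSubst k u t) v) (app (diff t (linSubst k u v)) v)
  | k, u, lam t => lam (linSubst (k + 1) (shift u) t)
  | _, _, zero => zero
  | k, u, sum t₁ t₂ => sum (linSubst k u t₁) (linSubst k u t₂)
  | k, u, diff t v => sum (diff (linSubst k u t) v) (diff t (linSubst k u v))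

end Tm

/-- Simple types over a set `P` of atomic types. -/
inductive Ty (P : Type v) : Type v
  | atom : P → Ty P
  | arrow : Ty P → Ty P → Ty P

/-- `Lookup Γ n τ`: the variable with index `n` has type `τ` in the context `Γ`. -/
inductive Lookup {P : Type v} : List (Ty P) → ℕ → Ty P → Type v
  | here (Γ : List (Ty P)) (τ : Ty P) : Lookup (τ :: Γ) 0 τ
  | there {Γ : List (Ty P)} {n : ℕ} {τ : Ty P} (ρ : Ty P) :
      Lookup Γ n τ → Lookup (ρ :: Γ) (n + 1) τ

/-- Derivations of the typing judgement `Γ ⊢ t : σ` on raw terms. -/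
inductive Der {P : Type v} : List (Ty P) → Tm → Ty P → Type v
  | var {Γ : List (Ty P)} {n : ℕ} {τ : Ty P} : Lookup Γ n τ → Der Γ (Tm.var n) τ
  | lam {Γ : List (Ty P)} {t : Tm} {τ σ : Ty P} :
      Der (τ :: Γ) t σ → Der Γ (Tm.lam t) (Ty.arrow τ σ)
  | app {Γ : List (Ty P)} {t u : Tm} {τ σ : Ty P} :
      Der Γ t (Ty.arrow τ σ) → Der Γ u τ → Der Γ (Tm.app t u) σ
  | zero (Γ : List (Ty P)) (σ : Ty P) : Der Γ Tm.zero σ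
  | sum {Γ : List (Ty P)} {t₁ t₂ : Tm} {σ : Ty P} :
      Der Γ t₁ σ → Der Γ t₂ σ → Der Γ (Tm.sum t₁ t₂) σ
  | diff {Γ : List (Ty P)} {t u : Tm} {τ σ : Ty P} :
      Der Γ t (Ty.arrow τ σ) → Der Γ u τ → Der Γ (Tm.diff t u) (Ty.arrow τ σ)

variable {P : Type v}

/-- Interpretation of types: `τ → σ` is `!τ ⊸ σ`. -/
def tySys (V : P → IntSystem.{u}) : Ty P → IntSystem.{u}
  | Ty.atom p => V p
  | Ty.arrow τ σ => IntSystem.lolli (IntSystem.bang (tySys V τ)) (tySys V σ)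

/-- Interpretation `!Γ` of contexts: the tensor product of the `!τ` for `τ` in `Γ`. -/
def ctxSys (V : P → IntSystem.{u}) : List (Ty P) → IntSystem.{u}
  | [] => IntSystem.one
  | τ :: Γ => IntSystem.tensor (IntSystem.bang (tySys V τ)) (ctxSys V Γ)

/-- States of `!Γ` are tuples of multisets; they are added componentwise. -/
instance ctxAddCommMonoid (V : P → IntSystem.{u}) :
    (Γ : List (Ty P)) → AddCommMonoid (ctxSys V Γ).State
  | [] => inferInstanceAs (AddCommMonoid PUnit.{u + 1})
  | τ :: Γ =>
      letI : AddCommMonoid (ctxSys V Γ).State := ctxAddCommMonoid V Γ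
      inferInstanceAs (AddCommMonoid (Multiset (tySys V τ).State × (ctxSys V Γ).State))

/-- Interpretation of a variable `x`: the pairs `(γ, s)` with `γ(x) = [s]` and `γ(y) = []` for
every other variable `y`. -/
def Lookup.interp (V : P → IntSystem.{u}) : {Γ : List (Ty P)} → {n : ℕ} → {τ : Ty P} →
    Lookup Γ n τ → Set ((ctxSys V Γ).State × (tySys V τ).State)
  | _, _, _, Lookup.here Γ τ =>
      {p | ∃ s : (tySys V τ).State,
        p = ((({s} : Multiset (tySys V τ).State), (0 : (ctxSys V Γ).State)), s)}
  | _, _, _, @Lookup.there _ Γ _ τ ρ x =>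
      {p | ∃ (γ : (ctxSys V Γ).State) (s : (tySys V τ).State), (γ, s) ∈ Lookup.interp V x ∧
        p = (((0 : Multiset (tySys V ρ).State), γ), s)}

/-- Relational interpretation of typed terms, as a relation between the states of `!Γ` and the
states of `σ`. In the application `(t)u`, the multiset `l` lists the pairs `(γᵢ, sᵢ) ∈ ⟦u⟧` such
that `γ = γ₀ + γ₁ + ... + γₙ` and `(γ₀, ([s₁, ..., sₙ], s)) ∈ ⟦t⟧`. -/
def Der.interp (V : P → IntSystem.{u}) : {Γ : List (Ty P)} → {t : Tm} → {σ : Ty P} →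
    Der Γ t σ → Set ((ctxSys V Γ).State × (tySys V σ).State)
  | _, _, _, Der.var x => Lookup.interp V x
  | _, _, _, @Der.lam _ Γ _ τ σ d =>
      {p | ∃ (γ : (ctxSys V Γ).State) (μ : Multiset (tySys V τ).State) (s : (tySys V σ).State),
        ((μ, γ), s) ∈ Der.interp V d ∧ p = (γ, (μ, s))}
  | _, _, _, @Der.app _ Γ _ _ τ σ d e =>
      {p | ∃ (γ₀ : (ctxSys V Γ).State) (l : Multiset ((ctxSys V Γ).State × (tySys V τ).State))
        (s : (tySys V σ).State),
        (γ₀, (l.map Prod.snd, s)) ∈ Der.interp V d ∧ (∀ q ∈ l, q ∈ Der.interp V e) ∧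
        p = (γ₀ + (l.map Prod.fst).sum, s)}
  | _, _, _, Der.zero _ _ => ∅
  | _, _, _, Der.sum d₁ d₂ => Der.interp V d₁ ∪ Der.interp V d₂
  | _, _, _, @Der.diff _ Γ _ _ τ σ d e =>
      {p | ∃ (γ₁ γ₂ : (ctxSys V Γ).State) (μ : Multiset (tySys V τ).State)
        (s : (tySys V τ).State) (s' : (tySys V σ).State),
        (γ₁, (μ + {s}, s')) ∈ Der.interp V d ∧ (γ₂, s) ∈ Der.interp V e ∧
        p = (γ₁ + γ₂, (μ, s'))}

end DiffLambda

/-!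
Let `r` be a relation between the states of two interaction systems. Whether `r` is a simulation
depends only on the sets of outcomes `{s[a/d] | d}` of the actions `a`. An action of `!w` in `μ`
amounts to a multiset of sets of outcomes, one for each element of `μ` (`mem_outcomes_bang`), so
that actions in a sum of multisets split and merge. Weakening, contraction and promotion follow,
and with them `Der.isSimulation_interp` by induction on the derivation.

For the two reduction rules, `Der.sem` interprets a derivation by a set of states weighted in an
arbitrary commutative monoid `M`, given weighted sets for the free variables. The relational
interpretation is the case where `M` is the monoid of states of `!Γ` and the variables are generic
(`Der.interp_eq_sem`). The interpretation is natural in `M` with respect to all relations that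
commute with finite sums (`Der.push_sem`), and β-reduction is the instance that replaces generic
elements by elements of the argument (`Der.appRel_lamRel_sem`). A relation `T₁` between monoids
that is a derivation over such a relation `T₀` obeys the Leibniz rule on applications, with the same
shape as the clauses of linear substitution. Hence `Der.exists_linSubst`, which yields the
differential reduction when `T₁` replaces one generic element by an element of the argument.

These arguments produce one derivation of the reduct. Derivations of the same judgement may differ
in the types of discarded or cut subterms, so that a coherence theorem is needed: `Der.sem_eq`.
It is proved by a logical relation between the weighted sets of two types, `LogRel`, which tests
functions on arguments with weights in an arbitrary fresh monoid. Since weights can be traced, the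
relation is equality between a type and itself (`logRel_self_iff`). It is stable under every
change of weights (`LogRel.push`), which reduces differential application to ordinary application
(`extApp_diffRel`).
-/

namespace DiffLambda

/-! ### Simulations through sets of outcomes -/

namespace IntSystem

/-- The sets of next states that the possible actions in the state `s` leave to the choice of
the reaction. Only these sets matter for simulations. -/
def outcomes (w : IntSystem.{u}) (s : w.State) : Set (Set w.State) :=
  Set.range fun a : w.Act s => Set.range (w.next s a)

end IntSystem

open IntSystem

theorem isSimulation_iff_outcomes {w₁ w₂ : IntSystem.{u}} {r : Set (w₁.State × w₂.State)} :
    IsSimulation w₁ w₂ r ↔ ∀ s₁ s₂, (s₁, s₂) ∈ r → ∀ X ∈ w₁.outcomes s₁,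
      ∃ Y ∈ w₂.outcomes s₂, ∀ y ∈ Y, ∃ x ∈ X, (x, y) ∈ r := by
  simp [IsSimulation, outcomes]

/-- Currying: a uniform response to all actions in `s₁` is one action of `w₁ ⊸ w₂`. -/
theorem exists_mem_outcomes_lolli {w₁ w₂ : IntSystem.{u}} {s₁ : w₁.State} {s₂ : w₂.State}
    {Q : w₁.State → w₂.State → Prop}
    (h : ∀ X ∈ w₁.outcomes s₁, ∃ Y ∈ w₂.outcomes s₂, ∀ y ∈ Y, ∃ x ∈ X, Q x y) :
    ∃ Z ∈ (lolli w₁ w₂).outcomes (s₁, s₂), ∀ x y, (x, y) ∈ Z → Q x y := by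
  simp only [outcomes, Set.forall_mem_range, Set.exists_range_iff] at h
  choose f G hG using h
  refine ⟨_, ⟨⟨f, G⟩, rfl⟩, ?_⟩
  rintro x y ⟨⟨a, d⟩, h⟩
  cases h
  exact hG a d

/-- Evaluation: an action of `w₁ ⊸ w₂` responds to every action in `s₁`. -/
theorem exists_mem_outcomes_of_lolli {w₁ w₂ : IntSystem.{u}} {s₁ : w₁.State} {s₂ : w₂.State}
    {Z : Set (w₁.State × w₂.State)} (hZ : Z ∈ (lolli w₁ w₂).outcomes (s₁, s₂))
    {X : Set w₁.State} (hX : X ∈ w₁.outcomes s₁) :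
    ∃ Y ∈ w₂.outcomes s₂, ∀ y ∈ Y, ∃ x ∈ X, (x, y) ∈ Z := by
  obtain ⟨⟨f, G⟩, rfl⟩ := hZ
  obtain ⟨a, rfl⟩ := hX
  refine ⟨_, ⟨f a, rfl⟩, ?_⟩
  rintro _ ⟨d, rfl⟩
  exact ⟨_, ⟨G a d, rfl⟩, ⟨a, d⟩, rfl⟩

theorem mem_outcomes_tensor {w₁ w₂ : IntSystem.{u}} {s₁ : w₁.State} {s₂ : w₂.State}
    {Z : Set (w₁.State × w₂.State)} :
    Z ∈ (tensor w₁ w₂).outcomes (s₁, s₂) ↔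
      ∃ X ∈ w₁.outcomes s₁, ∃ Y ∈ w₂.outcomes s₂, Z = X ×ˢ Y := by
  have key : ∀ (a : w₁.Act s₁) (b : w₂.Act s₂),
      Set.range ((tensor w₁ w₂).next (s₁, s₂) (a, b)) =
        Set.range (w₁.next s₁ a) ×ˢ Set.range (w₂.next s₂ b) := by
    intro a b
    rw [← Set.range_prodMap]
    rfl
  constructor
  · rintro ⟨⟨a, b⟩, rfl⟩
    exact ⟨_, ⟨a, rfl⟩, _, ⟨b, rfl⟩, key a b⟩
  · rintro ⟨_, ⟨a, rfl⟩, _, ⟨b, rfl⟩, rfl⟩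
    exact ⟨(a, b), key a b⟩

theorem mem_range_listNext_cons {w : IntSystem.{u}} {s : w.State} {l : List w.State}
    {a : w.Act s} {b : w.ListAct l} {ν : Multiset w.State} :
    (∃ d, (w.listNext (s :: l) (a, b) d : Multiset w.State) = ν) ↔
      ∃ x ∈ Set.range (w.next s a), ∃ ν', (∃ d, (w.listNext l b d : Multiset w.State) = ν') ∧
        ν = x ::ₘ ν' := by
  constructor
  · rintro ⟨⟨d, d'⟩, rfl⟩
    exact ⟨_, ⟨d, rfl⟩, _, ⟨d', rfl⟩, rfl⟩
  · rintro ⟨_, ⟨d, rfl⟩, _, ⟨d', rfl⟩, rfl⟩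
    exact ⟨(d, d'), rfl⟩

/-- Up to the choice of an enumeration, an action in the multiset `μ` assigns a set of outcomes
to each thread, and its own outcomes are the multisets that select one element of each of
these sets. -/
theorem mem_outcomes_bang {w : IntSystem.{u}} {μ : Multiset w.State}
    {X : Set (Multiset w.State)} :
    X ∈ (bang w).outcomes μ ↔ ∃ L : Multiset (Set w.State),
      Multiset.Rel (fun s Y => Y ∈ w.outcomes s) μ L ∧
        X = {ν | Multiset.Rel (fun x Y => x ∈ Y) ν L} := by
  constructor
  · rintro ⟨⟨⟨l, rfl⟩, a⟩, rfl⟩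
    suffices h : ∀ (l : List w.State) (a : w.ListAct l), ∃ L : Multiset (Set w.State),
        Multiset.Rel (fun s Y => Y ∈ w.outcomes s) l L ∧
        ∀ ν, (∃ d, (w.listNext l a d : Multiset w.State) = ν) ↔
          Multiset.Rel (fun x Y => x ∈ Y) ν L by
      obtain ⟨L, h₁, h₂⟩ := h l a
      exact ⟨L, h₁, Set.ext h₂⟩
    intro l
    induction l with
    | nil =>
      intro a
      refine ⟨0, Multiset.Rel.zero, fun ν => ?_⟩
      rw [Multiset.rel_zero_right]
      exact ⟨fun ⟨_, h⟩ => h.symm, fun h => ⟨PUnit.unit, h.symm⟩⟩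
    | cons s l ih =>
      rintro ⟨a, b⟩
      obtain ⟨L, h₁, h₂⟩ := ih b
      refine ⟨Set.range (w.next s a) ::ₘ L, Multiset.Rel.cons ⟨a, rfl⟩ h₁, fun ν => ?_⟩
      rw [mem_range_listNext_cons, Multiset.rel_cons_right]
      simp only [h₂, exists_and_left]
  · rintro ⟨L, h, rfl⟩
    suffices h : ∃ (l : List w.State) (a : w.ListAct l), (l : Multiset w.State) = μ ∧
        ∀ ν, (∃ d, (w.listNext l a d : Multiset w.State) = ν) ↔
          Multiset.Rel (fun x Y => x ∈ Y) ν L by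
      obtain ⟨l, a, rfl, h₂⟩ := h
      exact ⟨⟨⟨l, rfl⟩, a⟩, Set.ext h₂⟩
    induction h with
    | zero =>
      refine ⟨[], PUnit.unit, rfl, fun ν => ?_⟩
      rw [Multiset.rel_zero_right]
      exact ⟨fun ⟨_, h⟩ => h.symm, fun h => ⟨PUnit.unit, h.symm⟩⟩
    | cons h _ ih =>
      obtain ⟨l, b, rfl, h₂⟩ := ih
      obtain ⟨a, rfl⟩ := h
      refine ⟨_ :: l, (a, b), rfl, fun ν => ?_⟩
      rw [mem_range_listNext_cons, Multiset.rel_cons_right]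
      simp only [h₂, exists_and_left]

theorem mem_outcomes_bang_zero {w : IntSystem.{u}} {X : Set (Multiset w.State)} :
    X ∈ (bang w).outcomes (0 : Multiset w.State) ↔ X = {0} := by
  rw [mem_outcomes_bang]
  simp only [Multiset.rel_zero_left, exists_eq_left, Multiset.rel_zero_right]
  rfl

theorem mem_outcomes_bang_singleton {w : IntSystem.{u}} {s : w.State}
    {X : Set (Multiset w.State)} :
    X ∈ (bang w).outcomes ({s} : Multiset w.State) ↔
      ∃ Y ∈ w.outcomes s, X = (fun x => {x}) '' Y := by
  have key : ∀ Y : Set w.State,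
      {ν : Multiset w.State | Multiset.Rel (fun x Y => x ∈ Y) ν (Y ::ₘ 0)} =
        (fun x => {x}) '' Y := by
    intro Y
    ext ν
    simp only [Set.mem_ofPred_eq, Multiset.rel_cons_right, Multiset.rel_zero_right,
      Set.mem_image]
    constructor
    · rintro ⟨x, _, hx, rfl, rfl⟩
      exact ⟨x, hx, rfl⟩
    · rintro ⟨x, hx, rfl⟩
      exact ⟨x, 0, hx, rfl, rfl⟩
  rw [mem_outcomes_bang]
  simp only [← Multiset.cons_zero, Multiset.rel_cons_left, Multiset.rel_zero_left]
  constructor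
  · rintro ⟨_, ⟨Y, _, hY, rfl, rfl⟩, rfl⟩
    exact ⟨Y, hY, key Y⟩
  · rintro ⟨Y, hY, rfl⟩
    exact ⟨_, ⟨Y, _, hY, rfl, rfl⟩, (key Y).symm⟩

theorem mem_outcomes_bang_add {w : IntSystem.{u}} {μ₁ μ₂ : Multiset w.State}
    {X : Set (Multiset w.State)} :
    X ∈ (bang w).outcomes (μ₁ + μ₂) ↔
      ∃ X₁ X₂ : Set (Multiset w.State), X₁ ∈ (bang w).outcomes μ₁ ∧
        X₂ ∈ (bang w).outcomes μ₂ ∧ X = {ν | ∃ ν₁ ∈ X₁, ∃ ν₂ ∈ X₂, ν = ν₁ + ν₂} := by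
  have key : ∀ L₁ L₂ : Multiset (Set w.State),
      {ν : Multiset w.State | Multiset.Rel (fun x Y => x ∈ Y) ν (L₁ + L₂)} =
        {ν | ∃ ν₁ ∈ {ν : Multiset w.State | Multiset.Rel (fun x Y => x ∈ Y) ν L₁},
          ∃ ν₂ ∈ {ν : Multiset w.State | Multiset.Rel (fun x Y => x ∈ Y) ν L₂},
            ν = ν₁ + ν₂} := by
    intro L₁ L₂
    ext ν
    simp only [Set.mem_ofPred_eq, Multiset.rel_add_right]
    constructor
    · rintro ⟨a, b, h₁, h₂, h₃⟩
      exact ⟨a, h₁, b, h₂, h₃⟩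
    · rintro ⟨a, h₁, b, h₂, h₃⟩
      exact ⟨a, b, h₁, h₂, h₃⟩
  constructor
  · intro h
    obtain ⟨L, hL, rfl⟩ := mem_outcomes_bang.1 h
    obtain ⟨L₁, L₂, h₁, h₂, rfl⟩ := Multiset.rel_add_left.1 hL
    exact ⟨_, _, mem_outcomes_bang.2 ⟨L₁, h₁, rfl⟩, mem_outcomes_bang.2 ⟨L₂, h₂, rfl⟩,
      key L₁ L₂⟩
  · rintro ⟨X₁, X₂, h₁, h₂, rfl⟩
    obtain ⟨L₁, hL₁, rfl⟩ := mem_outcomes_bang.1 h₁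
    obtain ⟨L₂, hL₂, rfl⟩ := mem_outcomes_bang.1 h₂
    exact mem_outcomes_bang.2 ⟨L₁ + L₂, hL₁.add hL₂, (key L₁ L₂).symm⟩

variable {P : Type v}

/-- Weakening: no outcome but the empty tuple is possible in the empty tuple. -/
theorem zero_mem_of_mem_outcomes_ctxSys (V : P → IntSystem.{u}) :
    ∀ (Γ : List (Ty P)) {X : Set (ctxSys V Γ).State}, X ∈ (ctxSys V Γ).outcomes 0 → 0 ∈ X
  | [], _, ⟨_, hX⟩ => hX ▸ ⟨PUnit.unit, rfl⟩
  | τ :: Γ, _, hX => by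
    obtain ⟨X₁, h₁, X₂, h₂, rfl⟩ := mem_outcomes_tensor.1 hX
    rw [mem_outcomes_bang_zero.1 h₁]
    exact ⟨rfl, zero_mem_of_mem_outcomes_ctxSys V Γ h₂⟩

/-- Contraction: an action in a sum of tuples can be split into actions in the summands. -/
theorem exists_outcomes_ctxSys_of_add (V : P → IntSystem.{u}) :
    ∀ (Γ : List (Ty P)) {γ₁ γ₂ : (ctxSys V Γ).State} {X : Set (ctxSys V Γ).State},
      X ∈ (ctxSys V Γ).outcomes (γ₁ + γ₂) →
      ∃ X₁ ∈ (ctxSys V Γ).outcomes γ₁, ∃ X₂ ∈ (ctxSys V Γ).outcomes γ₂,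
        ∀ x₁ ∈ X₁, ∀ x₂ ∈ X₂, x₁ + x₂ ∈ X
  | [], _, _, _, ⟨_, hX⟩ =>
    ⟨_, ⟨PUnit.unit, rfl⟩, _, ⟨PUnit.unit, rfl⟩, fun _ _ _ _ => hX ▸ ⟨PUnit.unit, rfl⟩⟩
  | τ :: Γ, (μ₁, γ₁), (μ₂, γ₂), _, hX => by
    obtain ⟨X, h, Y, h', rfl⟩ := mem_outcomes_tensor.1 hX
    obtain ⟨X₁, X₂, h₁, h₂, rfl⟩ := mem_outcomes_bang_add.1 h
    obtain ⟨Y₁, h₁', Y₂, h₂', h'⟩ := exists_outcomes_ctxSys_of_add V Γ h'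
    refine ⟨_, mem_outcomes_tensor.2 ⟨X₁, h₁, Y₁, h₁', rfl⟩,
      _, mem_outcomes_tensor.2 ⟨X₂, h₂, Y₂, h₂', rfl⟩, ?_⟩
    rintro ⟨ν₁, y₁⟩ ⟨hν₁, hy₁⟩ ⟨ν₂, y₂⟩ ⟨hν₂, hy₂⟩
    exact ⟨⟨ν₁, hν₁, ν₂, hν₂, rfl⟩, h' y₁ hy₁ y₂ hy₂⟩

theorem Lookup.isSimulation_interp (V : P → IntSystem.{u}) {Γ : List (Ty P)} {n : ℕ} {τ : Ty P}
    (x : Lookup Γ n τ) : IsSimulation (ctxSys V Γ) (tySys V τ) (x.interp V) := by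
  rw [isSimulation_iff_outcomes]
  induction x with
  | here Γ τ =>
    rintro _ s ⟨_, ⟨⟩⟩ X hX
    obtain ⟨X₁, h₁, X₂, h₂, rfl⟩ := mem_outcomes_tensor.1 hX
    obtain ⟨Y, hY, rfl⟩ := mem_outcomes_bang_singleton.1 h₁
    exact ⟨Y, hY, fun y hy => ⟨_, ⟨⟨y, hy, rfl⟩, zero_mem_of_mem_outcomes_ctxSys V Γ h₂⟩,
      y, rfl⟩⟩
  | there ρ x ih =>
    rintro _ s ⟨γ, _, h, ⟨⟩⟩ X hX
    obtain ⟨X₁, h₁, X₂, h₂, rfl⟩ := mem_outcomes_tensor.1 hX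
    rw [mem_outcomes_bang_zero.1 h₁]
    obtain ⟨Y, hY, h'⟩ := ih γ s h X₂ h₂
    refine ⟨Y, hY, fun y hy => ?_⟩
    obtain ⟨γ', hγ', hx⟩ := h' y hy
    exact ⟨((0 : Multiset (tySys V ρ).State), γ'), ⟨rfl, hγ'⟩, γ', y, hx, rfl⟩

/-- Promotion: a simulation from `!Γ` to `w` lifts to one from `!Γ` to `!w`. -/
theorem exists_mem_outcomes_bang_of_isSimulation (V : P → IntSystem.{u}) {Γ : List (Ty P)}
    {w : IntSystem.{u}} {r : Set ((ctxSys V Γ).State × w.State)}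
    (hr : IsSimulation (ctxSys V Γ) w r)
    (l : Multiset ((ctxSys V Γ).State × w.State)) (hl : ∀ q ∈ l, q ∈ r)
    {X : Set (ctxSys V Γ).State} (hX : X ∈ (ctxSys V Γ).outcomes (l.map Prod.fst).sum) :
    ∃ Y ∈ (bang w).outcomes (l.map Prod.snd), ∀ μ ∈ Y,
      ∃ l' : Multiset ((ctxSys V Γ).State × w.State), (∀ q ∈ l', q ∈ r) ∧
        l'.map Prod.snd = μ ∧ (l'.map Prod.fst).sum ∈ X := by
  rw [isSimulation_iff_outcomes] at hr
  induction l using Multiset.induction_on generalizing X with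
  | empty =>
    refine ⟨{(0 : Multiset w.State)}, mem_outcomes_bang_zero.2 rfl, ?_⟩
    rintro _ rfl
    exact ⟨0, by simp, rfl, zero_mem_of_mem_outcomes_ctxSys V Γ hX⟩
  | cons q l ih =>
    rw [Multiset.map_cons, Multiset.sum_cons] at hX
    obtain ⟨X₁, h₁, X₂, h₂, hX'⟩ := exists_outcomes_ctxSys_of_add V Γ hX
    obtain ⟨Y₁, hY₁, h₁⟩ := hr q.1 q.2 (hl q (Multiset.mem_cons_self q l)) X₁ h₁
    obtain ⟨Y₂, hY₂, h₂⟩ := ih (fun q hq => hl q (Multiset.mem_cons_of_mem hq)) h₂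
    rw [Multiset.map_cons, ← Multiset.singleton_add]
    refine ⟨_, mem_outcomes_bang_add.2
      ⟨_, Y₂, mem_outcomes_bang_singleton.2 ⟨Y₁, hY₁, rfl⟩, hY₂, rfl⟩, ?_⟩
    rintro _ ⟨_, ⟨y, hy, rfl⟩, ν, hν, rfl⟩
    obtain ⟨x, hx, hxy⟩ := h₁ y hy
    obtain ⟨l', hl', rfl, hsum⟩ := h₂ ν hν
    refine ⟨(x, y) ::ₘ l', ?_, by simp, ?_⟩
    · simpa [hxy] using hl'
    · rw [Multiset.map_cons, Multiset.sum_cons]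
      exact hX' _ hx _ hsum

theorem Der.isSimulation_interp (V : P → IntSystem.{u}) {Γ : List (Ty P)} {t : Tm} {σ : Ty P}
    (d : Der Γ t σ) : IsSimulation (ctxSys V Γ) (tySys V σ) (d.interp V) := by
  induction d with
  | var x => exact x.isSimulation_interp V
  | lam d ih =>
    rw [isSimulation_iff_outcomes] at ih ⊢
    rintro γ ⟨μ, s⟩ ⟨_, _, _, h, ⟨⟩⟩ X hX
    obtain ⟨Z, hZ, hQ⟩ := exists_mem_outcomes_lolli (s₁ := μ) (s₂ := s)
      (Q := fun ν y => ∃ x ∈ X, ((ν, x), y) ∈ d.interp V) (w₁ := bang (tySys V _)) <| by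
        intro W hW
        obtain ⟨Y, hY, h'⟩ := ih (μ, γ) s h _ (mem_outcomes_tensor.2 ⟨W, hW, X, hX, rfl⟩)
        refine ⟨Y, hY, fun y hy => ?_⟩
        obtain ⟨⟨ν, x⟩, ⟨hν, hx⟩, hd⟩ := h' y hy
        exact ⟨ν, hν, x, hx, hd⟩
    refine ⟨Z, hZ, ?_⟩
    rintro ⟨ν, y⟩ hνy
    obtain ⟨x, hx, hd⟩ := hQ ν y hνy
    exact ⟨x, hx, x, ν, y, hd, rfl⟩
  | app d e ihd ihe =>
    rw [isSimulation_iff_outcomes] at ihd ⊢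
    rintro _ s ⟨γ₀, l, _, h, hl, ⟨⟩⟩ X hX
    obtain ⟨X₁, h₁, X₂, h₂, hX'⟩ := exists_outcomes_ctxSys_of_add V _ hX
    obtain ⟨Z, hZ, hZ'⟩ := ihd _ _ h X₁ h₁
    obtain ⟨W, hW, hW'⟩ := exists_mem_outcomes_bang_of_isSimulation V ihe l hl h₂
    obtain ⟨Y, hY, hY'⟩ := exists_mem_outcomes_of_lolli hZ hW
    refine ⟨Y, hY, fun y hy => ?_⟩
    obtain ⟨μ, hμ, hμy⟩ := hY' y hy
    obtain ⟨x₁, hx₁, hd⟩ := hZ' _ hμy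
    obtain ⟨l', hl', rfl, hx₂⟩ := hW' μ hμ
    exact ⟨_, hX' _ hx₁ _ hx₂, x₁, l', y, hd, hl', rfl⟩
  | zero => exact fun _ _ h => h.elim
  | sum d₁ d₂ ih₁ ih₂ =>
    rw [isSimulation_iff_outcomes] at ih₁ ih₂ ⊢
    rintro γ s (h | h) X hX
    · obtain ⟨Y, hY, h'⟩ := ih₁ γ s h X hX
      exact ⟨Y, hY, fun y hy => (h' y hy).imp fun x hx => ⟨hx.1, Or.inl hx.2⟩⟩
    · obtain ⟨Y, hY, h'⟩ := ih₂ γ s h X hX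
      exact ⟨Y, hY, fun y hy => (h' y hy).imp fun x hx => ⟨hx.1, Or.inr hx.2⟩⟩
  | @diff _ _ _ τ _ d e ihd ihe =>
    rw [isSimulation_iff_outcomes] at ihd ihe ⊢
    rintro _ ⟨μ, s'⟩ ⟨γ₁, γ₂, _, s, _, h, he, ⟨⟩⟩ X hX
    obtain ⟨X₁, h₁, X₂, h₂, hX'⟩ := exists_outcomes_ctxSys_of_add V _ hX
    obtain ⟨Z, hZ, hZ'⟩ := ihd _ _ h X₁ h₁
    obtain ⟨S, hS, hS'⟩ := ihe _ _ he X₂ h₂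
    obtain ⟨Z', hZ'', hQ⟩ := exists_mem_outcomes_lolli (s₁ := μ) (s₂ := s')
      (Q := fun (ν : Multiset (tySys V τ).State) y => ∃ z ∈ S,
        ((ν + {z} : Multiset (tySys V τ).State), y) ∈ Z) (w₁ := bang (tySys V _)) <| by
        intro W hW
        obtain ⟨Y, hY, h'⟩ := exists_mem_outcomes_of_lolli hZ (mem_outcomes_bang_add.2
          ⟨W, _, hW, mem_outcomes_bang_singleton.2 ⟨S, hS, rfl⟩, rfl⟩)
        refine ⟨Y, hY, fun y hy => ?_⟩
        obtain ⟨_, ⟨ν, hν, _, ⟨z, hz, rfl⟩, rfl⟩, hZy⟩ := h' y hy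
        exact ⟨ν, hν, z, hz, hZy⟩
    refine ⟨Z', hZ'', ?_⟩
    rintro ⟨ν, y⟩ hνy
    obtain ⟨z, hz, hZy⟩ := hQ ν y hνy
    obtain ⟨x₁, hx₁, hd⟩ := hZ' _ hZy
    obtain ⟨x₂, hx₂, hz'⟩ := hS' z hz
    exact ⟨_, hX' _ hx₁ _ hx₂, x₁, x₂, ν, z, y, hd, hz', rfl⟩

/-! ### Relations weighted by a commutative monoid -/

section Weighted

variable {M N X Y : Type u} [AddCommMonoid M] [AddCommMonoid N]

/-- Image of a weighted set under a relation between the weights. -/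
def push {M N X : Type u} (T : N → M → Prop) (A : Set (N × X)) : Set (M × X) :=
  {p | ∃ n, (n, p.2) ∈ A ∧ T n p.1}

/-- Promotion: the multisets of elements of `A`, weighted by the sum of the weights. -/
def prom (A : Set (M × X)) : Set (M × Multiset X) :=
  {p | ∃ l : Multiset (M × X), (∀ q ∈ l, q ∈ A) ∧ l.map Prod.snd = p.2 ∧
    (l.map Prod.fst).sum = p.1}

/-- Application of weighted relations. -/
def appRel (A : Set (M × (Multiset X × Y))) (B : Set (M × X)) : Set (M × Y) :=
  {p | ∃ m₁ m₂ μ, (m₁, (μ, p.2)) ∈ A ∧ (m₂, μ) ∈ prom B ∧ p.1 = m₁ + m₂}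

/-- Differential application of weighted relations. -/
def diffRel (A : Set (M × (Multiset X × Y))) (B : Set (M × X)) : Set (M × (Multiset X × Y)) :=
  {p | ∃ m₁ m₂ s, (m₁, (p.2.1 + {s}, p.2.2)) ∈ A ∧ (m₂, s) ∈ B ∧ p.1 = m₁ + m₂}

/-- Abstraction of weighted relations. -/
def lamRel {M X Y : Type u} (A : Set ((Multiset X × M) × Y)) : Set (M × (Multiset X × Y)) :=
  {p | ((p.2.1, p.1), p.2.2) ∈ A}

/-- The generic weighted set: every element is its own weight. -/
def generic (M X : Type u) [AddCommMonoid M] : Set ((Multiset X × M) × X) :=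
  {p | p.1 = ({p.2}, 0)}

/-- The inclusion `m ↦ (0, m)`, as a relation. -/
def inrRel (N : Type*) {M : Type*} [Zero N] (m : M) (p : N × M) : Prop := p = (0, m)

/-- The inclusion `m ↦ (m, 0)`, as a relation. -/
def inlRel (N : Type*) {M : Type*} [Zero N] (m : M) (p : M × N) : Prop := p = (m, 0)

/-- Relations between commutative monoids which commute with finite sums. -/
structure IsAdditive (T : N → M → Prop) : Prop where
  zero : ∀ m, T 0 m ↔ m = 0
  add : ∀ n n' m, T (n + n') m ↔ ∃ m₁ m₂, T n m₁ ∧ T n' m₂ ∧ m = m₁ + m₂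

/-- Relations which obey the Leibniz rule with respect to an additive relation `T₀`. -/
structure IsDerivation (T₀ T₁ : N → M → Prop) : Prop where
  additive : IsAdditive T₀
  zero : ∀ m, ¬ T₁ 0 m
  add : ∀ n n' m, T₁ (n + n') m ↔ (∃ m₁ m₂, T₁ n m₁ ∧ T₀ n' m₂ ∧ m = m₁ + m₂) ∨
    ∃ m₁ m₂, T₀ n m₁ ∧ T₁ n' m₂ ∧ m = m₁ + m₂

theorem isAdditive_inlRel : IsAdditive (inlRel N (M := M)) := by
  constructor
  · simp [inlRel]
  · rintro n n' ⟨a, b⟩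
    simp [inlRel]

theorem isAdditive_inrRel : IsAdditive (inrRel N (M := M)) := by
  constructor
  · simp [inrRel]
  · rintro n n' ⟨a, b⟩
    simp [inrRel]

/-- The action of a relation on the second component of a pair. -/
def idProd (L : Type*) {M N : Type*} (T : N → M → Prop) (p : L × N) (q : L × M) : Prop :=
  q.1 = p.1 ∧ T p.2 q.2

theorem IsAdditive.idProd {L : Type*} [AddCommMonoid L] {T : N → M → Prop} (hT : IsAdditive T) :
    IsAdditive (DiffLambda.idProd L T) := by
  constructor
  · rintro ⟨a, m⟩
    simp [DiffLambda.idProd, hT.zero]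
  · rintro ⟨a, n⟩ ⟨a', n'⟩ ⟨b, m⟩
    simp only [DiffLambda.idProd, Prod.mk_add_mk, hT.add, Prod.exists, Prod.mk.injEq]
    constructor
    · rintro ⟨rfl, m₁, m₂, h₁, h₂, rfl⟩
      exact ⟨a, m₁, a', m₂, ⟨rfl, h₁⟩, ⟨rfl, h₂⟩, rfl, rfl⟩
    · rintro ⟨_, m₁, _, m₂, ⟨rfl, h₁⟩, ⟨rfl, h₂⟩, rfl, rfl⟩
      exact ⟨rfl, m₁, m₂, h₁, h₂, rfl⟩

theorem IsDerivation.idProd {L : Type*} [AddCommMonoid L] {T₀ T₁ : N → M → Prop}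
    (hT : IsDerivation T₀ T₁) :
    IsDerivation (DiffLambda.idProd L T₀) (DiffLambda.idProd L T₁) := by
  constructor
  · exact hT.additive.idProd
  · rintro ⟨a, m⟩ h
    exact hT.zero m h.2
  · rintro ⟨a, n⟩ ⟨a', n'⟩ ⟨b, m⟩
    simp only [DiffLambda.idProd, Prod.mk_add_mk, hT.add, Prod.exists, Prod.mk.injEq]
    constructor
    · rintro ⟨rfl, ⟨m₁, m₂, h₁, h₂, rfl⟩ | ⟨m₁, m₂, h₁, h₂, rfl⟩⟩
      · exact Or.inl ⟨a, m₁, a', m₂, ⟨rfl, h₁⟩, ⟨rfl, h₂⟩, rfl, rfl⟩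
      · exact Or.inr ⟨a, m₁, a', m₂, ⟨rfl, h₁⟩, ⟨rfl, h₂⟩, rfl, rfl⟩
    · rintro (⟨_, m₁, _, m₂, ⟨rfl, h₁⟩, ⟨rfl, h₂⟩, rfl, rfl⟩ |
        ⟨_, m₁, _, m₂, ⟨rfl, h₁⟩, ⟨rfl, h₂⟩, rfl, rfl⟩)
      · exact ⟨rfl, Or.inl ⟨m₁, m₂, h₁, h₂, rfl⟩⟩
      · exact ⟨rfl, Or.inr ⟨m₁, m₂, h₁, h₂, rfl⟩⟩

theorem mem_push {M N X : Type u} {T : N → M → Prop} {A : Set (N × X)} {m : M} {s : X} :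
    (m, s) ∈ push T A ↔ ∃ n, (n, s) ∈ A ∧ T n m := Iff.rfl

theorem mem_appRel {A : Set (M × (Multiset X × Y))} {B : Set (M × X)} {m : M} {s : Y} :
    (m, s) ∈ appRel A B ↔
      ∃ m₁ m₂ μ, (m₁, (μ, s)) ∈ A ∧ (m₂, μ) ∈ prom B ∧ m = m₁ + m₂ := Iff.rfl

theorem mem_diffRel {A : Set (M × (Multiset X × Y))} {B : Set (M × X)} {m : M} {μ : Multiset X}
    {s' : Y} : (m, (μ, s')) ∈ diffRel A B ↔
      ∃ m₁ m₂ s, (m₁, (μ + {s}, s')) ∈ A ∧ (m₂, s) ∈ B ∧ m = m₁ + m₂ := Iff.rfl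

theorem mem_inl_push {M N X : Type u} [AddCommMonoid N] {A : Set (M × X)} {m : M} {n : N} {s : X} :
    ((m, n), s) ∈ push (inlRel N) A ↔ (m, s) ∈ A ∧ n = 0 := by
  simp only [mem_push, inlRel, Prod.mk.injEq]
  exact ⟨fun ⟨_, h, h₁, h₂⟩ => h₁ ▸ ⟨h, h₂⟩, fun ⟨h, h₂⟩ => ⟨_, h, rfl, h₂⟩⟩

theorem mem_inr_push {M N X : Type u} [AddCommMonoid N] {A : Set (M × X)} {m : M} {n : N} {s : X} :
    ((n, m), s) ∈ push (inrRel N) A ↔ (m, s) ∈ A ∧ n = 0 := by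
  simp only [mem_push, inrRel, Prod.mk.injEq]
  exact ⟨fun ⟨_, h, h₁, h₂⟩ => h₂ ▸ ⟨h, h₁⟩, fun ⟨h, h₂⟩ => ⟨_, h, h₂, rfl⟩⟩

theorem push_union {M N X : Type u} (T : N → M → Prop) (A B : Set (N × X)) :
    push T (A ∪ B) = push T A ∪ push T B := by
  ext ⟨m, s⟩
  simp only [mem_push, Set.mem_union, or_and_right, exists_or]

theorem push_empty {M N X : Type u} (T : N → M → Prop) :
    push T (∅ : Set (N × X)) = ∅ := by
  ext ⟨m, s⟩
  simp [mem_push]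

/-! ### Promotion -/

theorem mem_prom_zero {A : Set (M × X)} {m : M} : (m, 0) ∈ prom A ↔ m = 0 := by
  constructor
  · rintro ⟨l, _, h, rfl⟩
    rw [Multiset.map_eq_zero] at h
    simp [h]
  · rintro rfl
    exact ⟨0, by simp, by simp, by simp⟩

theorem mem_prom_cons {A : Set (M × X)} {m : M} {s : X} {μ : Multiset X} :
    (m, s ::ₘ μ) ∈ prom A ↔ ∃ m₁ m₂, (m₁, s) ∈ A ∧ (m₂, μ) ∈ prom A ∧ m = m₁ + m₂ := by
  classical
  constructor
  · rintro ⟨l, hl, h, rfl⟩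
    obtain ⟨q, hq, rfl, h'⟩ := (Multiset.map_eq_cons _ _ _ _).2 h
    refine ⟨q.1, ((l.erase q).map Prod.fst).sum, hl q hq,
      ⟨l.erase q, fun q' hq' => hl q' (Multiset.mem_of_mem_erase hq'), h', rfl⟩, ?_⟩
    rw [← Multiset.sum_cons, ← Multiset.map_cons, Multiset.cons_erase hq]
  · rintro ⟨m₁, _, hs, ⟨l, hl, rfl, rfl⟩, rfl⟩
    exact ⟨(m₁, s) ::ₘ l, by simpa [hs] using hl, by simp, by simp⟩

theorem mem_prom_singleton {A : Set (M × X)} {m : M} {s : X} :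
    (m, {s}) ∈ prom A ↔ (m, s) ∈ A := by
  rw [← Multiset.cons_zero, mem_prom_cons]
  simp [mem_prom_zero]

theorem mem_prom_add {A : Set (M × X)} {m : M} {μ ν : Multiset X} :
    (m, μ + ν) ∈ prom A ↔ ∃ m₁ m₂, (m₁, μ) ∈ prom A ∧ (m₂, ν) ∈ prom A ∧ m = m₁ + m₂ := by
  induction μ using Multiset.induction_on generalizing m with
  | empty => simp [mem_prom_zero]
  | cons s μ ih =>
    rw [Multiset.cons_add]
    simp only [mem_prom_cons, ih]
    constructor
    · rintro ⟨a, _, ha, ⟨b, c, hb, hc, rfl⟩, rfl⟩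
      exact ⟨_, c, ⟨a, b, ha, hb, rfl⟩, hc, (add_assoc a b c).symm⟩
    · rintro ⟨_, c, ⟨a, b, ha, hb, rfl⟩, hc, rfl⟩
      exact ⟨a, _, ha, ⟨b, c, hb, hc, rfl⟩, add_assoc a b c⟩

theorem mem_prom_push {T : N → M → Prop} (hT : IsAdditive T) {A : Set (N × X)} {m : M}
    {μ : Multiset X} : (m, μ) ∈ prom (push T A) ↔ ∃ n, (n, μ) ∈ prom A ∧ T n m := by
  induction μ using Multiset.induction_on generalizing m with
  | empty => simp [mem_prom_zero, hT.zero]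
  | cons s μ ih =>
    simp only [mem_prom_cons, ih]
    constructor
    · rintro ⟨m₁, m₂, ⟨n₁, h₁, hm₁⟩, ⟨n₂, h₂, hm₂⟩, rfl⟩
      exact ⟨_, ⟨n₁, n₂, h₁, h₂, rfl⟩, (hT.add _ _ _).2 ⟨m₁, m₂, hm₁, hm₂, rfl⟩⟩
    · rintro ⟨_, ⟨n₁, n₂, h₁, h₂, rfl⟩, h⟩
      obtain ⟨m₁, m₂, hm₁, hm₂, rfl⟩ := (hT.add _ _ _).1 h
      exact ⟨m₁, m₂, ⟨n₁, h₁, hm₁⟩, ⟨n₂, h₂, hm₂⟩, rfl⟩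

/-- A derivation acts on exactly one element of a promoted multiset. -/
theorem exists_mem_prom_and_derivation {T₀ T₁ : N → M → Prop} (hT : IsDerivation T₀ T₁)
    {A : Set (N × X)} {m : M} {μ : Multiset X} :
    (∃ n, (n, μ) ∈ prom A ∧ T₁ n m) ↔ ∃ s ν m₁ m₂, μ = ν + {s} ∧
      (m₁, ν) ∈ prom (push T₀ A) ∧ (m₂, s) ∈ push T₁ A ∧ m = m₁ + m₂ := by
  constructor
  · rintro ⟨n, hn, h⟩
    induction μ using Multiset.induction_on generalizing n m with
    | empty =>
      rw [mem_prom_zero] at hn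
      exact (hT.zero m (hn ▸ h)).elim
    | cons a μ ih =>
      obtain ⟨n₁, n₂, h₁, h₂, rfl⟩ := mem_prom_cons.1 hn
      obtain ⟨m₁, m₂, hm₁, hm₂, rfl⟩ | ⟨m₁, m₂, hm₁, hm₂, rfl⟩ := (hT.add _ _ _).1 h
      · exact ⟨a, μ, m₂, m₁, by rw [add_comm, Multiset.singleton_add],
          (mem_prom_push hT.additive).2 ⟨n₂, h₂, hm₂⟩, ⟨n₁, h₁, hm₁⟩, add_comm _ _⟩
      · obtain ⟨s, ν, k₁, k₂, rfl, hk₁, hk₂, rfl⟩ := ih n₂ h₂ hm₂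
        exact ⟨s, a ::ₘ ν, m₁ + k₁, k₂, (Multiset.cons_add a ν {s}).symm,
          mem_prom_cons.2 ⟨m₁, k₁, ⟨n₁, h₁, hm₁⟩, hk₁, rfl⟩, hk₂, (add_assoc _ _ _).symm⟩
  · rintro ⟨s, ν, m₁, m₂, rfl, h₁, ⟨n₂, h₂, hm₂⟩, rfl⟩
    obtain ⟨n₁, h₁, hm₁⟩ := (mem_prom_push hT.additive).1 h₁
    exact ⟨_, mem_prom_add.2 ⟨n₁, n₂, h₁, mem_prom_singleton.2 h₂, rfl⟩,
      (hT.add _ _ _).2 (Or.inr ⟨m₁, m₂, hm₁, hm₂, rfl⟩)⟩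

/-! ### Changes of weights and the operations on weighted relations -/

theorem push_appRel {T : N → M → Prop} (hT : IsAdditive T) (A : Set (N × (Multiset X × Y)))
    (B : Set (N × X)) : push T (appRel A B) = appRel (push T A) (push T B) := by
  ext ⟨m, s⟩
  simp only [mem_push, mem_appRel, mem_prom_push hT]
  constructor
  · rintro ⟨_, ⟨n₁, n₂, μ, h₁, h₂, rfl⟩, h⟩
    obtain ⟨m₁, m₂, hm₁, hm₂, rfl⟩ := (hT.add _ _ _).1 h
    exact ⟨m₁, m₂, μ, ⟨n₁, h₁, hm₁⟩, ⟨n₂, h₂, hm₂⟩, rfl⟩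
  · rintro ⟨m₁, m₂, μ, ⟨n₁, h₁, hm₁⟩, ⟨n₂, h₂, hm₂⟩, rfl⟩
    exact ⟨_, ⟨n₁, n₂, μ, h₁, h₂, rfl⟩, (hT.add _ _ _).2 ⟨m₁, m₂, hm₁, hm₂, rfl⟩⟩

theorem push_diffRel {T : N → M → Prop} (hT : IsAdditive T) (A : Set (N × (Multiset X × Y)))
    (B : Set (N × X)) : push T (diffRel A B) = diffRel (push T A) (push T B) := by
  ext ⟨m, μ, s'⟩
  simp only [mem_push, mem_diffRel]
  constructor
  · rintro ⟨_, ⟨n₁, n₂, s, h₁, h₂, rfl⟩, h⟩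
    obtain ⟨m₁, m₂, hm₁, hm₂, rfl⟩ := (hT.add _ _ _).1 h
    exact ⟨m₁, m₂, s, ⟨n₁, h₁, hm₁⟩, ⟨n₂, h₂, hm₂⟩, rfl⟩
  · rintro ⟨m₁, m₂, s, ⟨n₁, h₁, hm₁⟩, ⟨n₂, h₂, hm₂⟩, rfl⟩
    exact ⟨_, ⟨n₁, n₂, s, h₁, h₂, rfl⟩, (hT.add _ _ _).2 ⟨m₁, m₂, hm₁, hm₂, rfl⟩⟩

theorem push_lamRel {M N X Y : Type u} (T : N → M → Prop) (A : Set ((Multiset X × N) × Y)) :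
    push T (lamRel A) = lamRel (push (idProd (Multiset X) T) A) := by
  ext ⟨m, μ, s⟩
  constructor
  · rintro ⟨n, h, hT⟩
    exact ⟨(μ, n), h, rfl, hT⟩
  · rintro ⟨⟨_, n⟩, h, ⟨⟩, hT⟩
    exact ⟨n, h, hT⟩

theorem push_idProd_generic {T : N → M → Prop} (hT : ∀ m, T 0 m ↔ m = 0) :
    push (idProd (Multiset X) T) (generic N X) = generic M X := by
  ext ⟨⟨μ, m⟩, s⟩
  simp [mem_push, generic, idProd, hT]

theorem push_idProd_inrRel {L M N X : Type u} [AddCommMonoid L] (T : N → M → Prop)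
    (A : Set (N × X)) :
    push (idProd L T) (push (inrRel L) A) = push (inrRel L) (push T A) := by
  ext ⟨⟨μ, m⟩, s⟩
  simp only [mem_push, inrRel, idProd, Prod.mk.injEq]
  constructor
  · rintro ⟨_, ⟨n, h, rfl⟩, rfl, hT⟩
    exact ⟨m, ⟨n, h, hT⟩, rfl, rfl⟩
  · rintro ⟨_, ⟨n, h, hT⟩, rfl, rfl⟩
    exact ⟨_, ⟨n, h, rfl⟩, rfl, hT⟩

/-- Leibniz rule for the application. -/
theorem IsDerivation.push_appRel {T₀ T₁ : N → M → Prop} (hT : IsDerivation T₀ T₁)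
    (A : Set (N × (Multiset X × Y))) (B : Set (N × X)) :
    push T₁ (appRel A B) = appRel (push T₁ A) (push T₀ B) ∪
      appRel (diffRel (push T₀ A) (push T₁ B)) (push T₀ B) := by
  ext ⟨m, s⟩
  simp only [mem_push, mem_appRel, mem_diffRel, Set.mem_union]
  constructor
  · rintro ⟨_, ⟨n₁, n₂, μ, h₁, h₂, rfl⟩, h⟩
    obtain ⟨m₁, m₂, hm₁, hm₂, rfl⟩ | ⟨m₁, m₂, hm₁, hm₂, rfl⟩ := (hT.add _ _ _).1 h
    · exact Or.inl ⟨m₁, m₂, μ, ⟨n₁, h₁, hm₁⟩, (mem_prom_push hT.additive).2 ⟨n₂, h₂, hm₂⟩, rfl⟩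
    · obtain ⟨a, ν, k₁, k₂, rfl, hk₁, hk₂, rfl⟩ :=
        (exists_mem_prom_and_derivation hT).1 ⟨n₂, h₂, hm₂⟩
      exact Or.inr ⟨m₁ + k₂, k₁, ν, ⟨m₁, k₂, a, ⟨n₁, h₁, hm₁⟩, hk₂, rfl⟩, hk₁, by abel⟩
  · rintro (⟨m₁, m₂, μ, ⟨n₁, h₁, hm₁⟩, h₂, rfl⟩ |
      ⟨_, k₁, ν, ⟨m₁, k₂, a, ⟨n₁, h₁, hm₁⟩, hk₂, rfl⟩, hk₁, rfl⟩)
    · obtain ⟨n₂, h₂, hm₂⟩ := (mem_prom_push hT.additive).1 h₂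
      exact ⟨_, ⟨n₁, n₂, μ, h₁, h₂, rfl⟩, (hT.add _ _ _).2 (Or.inl ⟨m₁, m₂, hm₁, hm₂, rfl⟩)⟩
    · obtain ⟨n₂, h₂, hm₂⟩ :=
        (exists_mem_prom_and_derivation hT).2 ⟨a, ν, k₁, k₂, rfl, hk₁, hk₂, rfl⟩
      exact ⟨_, ⟨n₁, n₂, ν + {a}, h₁, h₂, rfl⟩,
        (hT.add _ _ _).2 (Or.inr ⟨m₁, _, hm₁, hm₂, by abel⟩)⟩

/-- Leibniz rule for the differential application. -/
theorem IsDerivation.push_diffRel {T₀ T₁ : N → M → Prop} (hT : IsDerivation T₀ T₁)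
    (A : Set (N × (Multiset X × Y))) (B : Set (N × X)) :
    push T₁ (diffRel A B) =
      diffRel (push T₁ A) (push T₀ B) ∪ diffRel (push T₀ A) (push T₁ B) := by
  ext ⟨m, μ, s'⟩
  simp only [mem_push, mem_diffRel, Set.mem_union]
  constructor
  · rintro ⟨_, ⟨n₁, n₂, s, h₁, h₂, rfl⟩, h⟩
    obtain ⟨m₁, m₂, hm₁, hm₂, rfl⟩ | ⟨m₁, m₂, hm₁, hm₂, rfl⟩ := (hT.add _ _ _).1 h
    · exact Or.inl ⟨m₁, m₂, s, ⟨n₁, h₁, hm₁⟩, ⟨n₂, h₂, hm₂⟩, rfl⟩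
    · exact Or.inr ⟨m₁, m₂, s, ⟨n₁, h₁, hm₁⟩, ⟨n₂, h₂, hm₂⟩, rfl⟩
  · rintro (⟨m₁, m₂, s, ⟨n₁, h₁, hm₁⟩, ⟨n₂, h₂, hm₂⟩, rfl⟩ |
      ⟨m₁, m₂, s, ⟨n₁, h₁, hm₁⟩, ⟨n₂, h₂, hm₂⟩, rfl⟩)
    · exact ⟨_, ⟨n₁, n₂, s, h₁, h₂, rfl⟩,
        (hT.add _ _ _).2 (Or.inl ⟨m₁, m₂, hm₁, hm₂, rfl⟩)⟩
    · exact ⟨_, ⟨n₁, n₂, s, h₁, h₂, rfl⟩,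
        (hT.add _ _ _).2 (Or.inr ⟨m₁, m₂, hm₁, hm₂, rfl⟩)⟩

/-- Replacement of the generic elements in a weight by weighted elements of `B`. -/
def betaRel (B : Set (M × X)) (p : Multiset X × M) (k : M) : Prop :=
  ∃ n, (n, p.1) ∈ prom B ∧ k = p.2 + n

theorem isAdditive_betaRel (B : Set (M × X)) : IsAdditive (betaRel B) := by
  constructor
  · intro m
    simp [betaRel, mem_prom_zero]
  · rintro ⟨μ, n⟩ ⟨μ', n'⟩ m
    simp only [betaRel, Prod.mk_add_mk, mem_prom_add]
    constructor
    · rintro ⟨_, ⟨m₁, m₂, h₁, h₂, rfl⟩, rfl⟩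
      exact ⟨_, _, ⟨m₁, h₁, rfl⟩, ⟨m₂, h₂, rfl⟩, by abel⟩
    · rintro ⟨_, _, ⟨m₁, h₁, rfl⟩, ⟨m₂, h₂, rfl⟩, rfl⟩
      exact ⟨_, ⟨m₁, m₂, h₁, h₂, rfl⟩, by abel⟩

theorem push_betaRel (B : Set (M × X)) (A : Set ((Multiset X × M) × Y)) :
    push (betaRel B) A = appRel (lamRel A) B := by
  ext ⟨m, s⟩
  constructor
  · rintro ⟨⟨μ, m₁⟩, h, m₂, h₂, rfl⟩
    exact ⟨m₁, m₂, μ, h, h₂, rfl⟩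
  · rintro ⟨m₁, m₂, μ, h, h₂, rfl⟩
    exact ⟨⟨μ, m₁⟩, h, m₂, h₂, rfl⟩

theorem push_betaRel_generic (B : Set (M × X)) : push (betaRel B) (generic M X) = B := by
  ext ⟨m, s⟩
  constructor
  · rintro ⟨p, hp, m₂, h₂, h⟩
    obtain rfl : p = ({s}, 0) := hp
    obtain rfl : m = m₂ := h.trans (zero_add m₂)
    exact mem_prom_singleton.1 h₂
  · intro h
    exact ⟨({s}, 0), rfl, m, mem_prom_singleton.2 h, (zero_add m).symm⟩

theorem push_betaRel_inrRel (B : Set (M × X)) (A : Set (M × Y)) :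
    push (betaRel B) (push (inrRel (Multiset X)) A) = A := by
  ext ⟨m, s⟩
  constructor
  · rintro ⟨_, ⟨n, h, rfl⟩, k, hk, hm⟩
    obtain rfl : m = n := by simpa [mem_prom_zero.1 hk] using hm
    exact h
  · intro h
    exact ⟨(0, m), ⟨m, h, rfl⟩, 0, mem_prom_zero.2 rfl, (add_zero m).symm⟩

end Weighted

/-! ### Interpretation in environments -/


/-- Environments assign to each variable of the context a weighted set of states of its type. -/
def Env (V : P → IntSystem.{u}) (M : Type u) (Γ : List (Ty P)) : Type (max u v) :=
  ∀ ⦃n : ℕ⦄ ⦃τ : Ty P⦄, Lookup Γ n τ → Set (M × (tySys V τ).State)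

namespace Env

variable {V : P → IntSystem.{u}} {M N : Type u} {Γ : List (Ty P)} {τ : Ty P}

/-- Extension of an environment by a value for the variable `0`. -/
def cons (B : Set (M × (tySys V τ).State)) (θ : Env V M Γ) : Env V M (τ :: Γ)
  | _, _, Lookup.here _ _ => B
  | _, _, Lookup.there _ x => θ x

/-- Change of weights in an environment. -/
def map (T : N → M → Prop) (θ : Env V N Γ) : Env V M Γ := fun _ _ x => push T (θ x)

/-- Extension of an environment under a binder, by the generic weighted set. -/
def up [AddCommMonoid M] (τ : Ty P) (θ : Env V M Γ) :
    Env V (Multiset (tySys V τ).State × M) (τ :: Γ) :=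
  cons (generic M (tySys V τ).State) (θ.map (inrRel (Multiset (tySys V τ).State)))

theorem ext_cons {θ θ' : Env V M (τ :: Γ)} (h : θ (Lookup.here Γ τ) = θ' (Lookup.here Γ τ))
    (h' : ∀ ⦃n ρ⦄ (x : Lookup Γ n ρ), θ (x.there τ) = θ' (x.there τ)) : θ = θ' := by
  funext n ρ x
  cases x with
  | here => exact h
  | there _ x => exact h' x

variable [AddCommMonoid M] [AddCommMonoid N]

theorem map_idProd_up {T : N → M → Prop} (hT : ∀ m, T 0 m ↔ m = 0) (θ : Env V N Γ) :
    (θ.up τ).map (idProd _ T) = (θ.map T).up τ :=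
  ext_cons (push_idProd_generic hT) fun _ _ x => push_idProd_inrRel T (θ x)

theorem map_betaRel_up (B : Set (M × (tySys V τ).State)) (θ : Env V M Γ) :
    (θ.up τ).map (betaRel B) = cons B θ :=
  ext_cons (push_betaRel_generic B) fun _ _ x => push_betaRel_inrRel B (θ x)

end Env

/-- Interpretation of a derivation in an environment, for an arbitrary monoid of weights. The
body of an abstraction is interpreted with fresh weights for the bound variable. -/
def Der.sem (V : P → IntSystem.{u}) : {Γ : List (Ty P)} → {t : Tm} → {σ : Ty P} → Der Γ t σ →
    (M : Type u) → [AddCommMonoid M] → Env V M Γ → Set (M × (tySys V σ).State)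
  | _, _, _, Der.var x, _, _, θ => θ x
  | _, _, _, @Der.lam _ _ _ τ _ d, _, _, θ => lamRel (Der.sem V d _ (θ.up τ))
  | _, _, _, Der.app d e, M, _, θ => appRel (Der.sem V d M θ) (Der.sem V e M θ)
  | _, _, _, Der.zero _ _, _, _, _ => ∅
  | _, _, _, Der.sum d₁ d₂, M, _, θ => Der.sem V d₁ M θ ∪ Der.sem V d₂ M θ
  | _, _, _, Der.diff d e, M, _, θ => diffRel (Der.sem V d M θ) (Der.sem V e M θ)

/-- The environment of the weights `!Γ`, in which each variable is generic. -/
def genEnv (V : P → IntSystem.{u}) (Γ : List (Ty P)) : Env V (ctxSys V Γ).State Γ :=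
  fun _ _ x => x.interp V

theorem genEnv_cons (V : P → IntSystem.{u}) (τ : Ty P) (Γ : List (Ty P)) :
    genEnv V (τ :: Γ) = (genEnv V Γ).up τ := by
  refine Env.ext_cons ?_ fun n ρ x => ?_
  · ext ⟨γ, s⟩
    constructor
    · rintro ⟨s', ⟨⟩⟩
      rfl
    · intro h
      exact ⟨s, Prod.ext h rfl⟩
  · ext ⟨γ, s⟩
    constructor
    · rintro ⟨γ', s', h, ⟨⟩⟩
      exact ⟨γ', h, rfl⟩
    · rintro ⟨γ', h, h'⟩
      exact ⟨γ', s, h, Prod.ext h' rfl⟩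

theorem Der.interp_eq_sem (V : P → IntSystem.{u}) {Γ : List (Ty P)} {t : Tm} {σ : Ty P}
    (d : Der Γ t σ) : d.interp V = d.sem V (ctxSys V Γ).State (genEnv V Γ) := by
  induction d with
  | var x => rfl
  | @lam Γ _ τ _ d ih =>
    have ih' : d.interp V = d.sem V (Multiset (tySys V τ).State × (ctxSys V Γ).State)
        ((genEnv V Γ).up τ) := by
      rw [ih, ← genEnv_cons]
      rfl
    ext ⟨γ, μ, s⟩
    constructor
    · rintro ⟨_, _, _, h, ⟨⟩⟩
      exact (Set.ext_iff.1 ih' _).1 h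
    · intro h
      exact ⟨γ, μ, s, (Set.ext_iff.1 ih' _).2 h, rfl⟩
  | app d e ihd ihe =>
    ext ⟨γ, s⟩
    constructor
    · rintro ⟨γ₀, l, _, h, hl, ⟨⟩⟩
      exact ⟨γ₀, _, _, ihd ▸ h, ⟨l, fun q hq => ihe ▸ hl q hq, rfl, rfl⟩, rfl⟩
    · rintro ⟨γ₀, _, _, h, ⟨l, hl, rfl, rfl⟩, h'⟩
      exact ⟨γ₀, l, s, ihd.symm ▸ h, fun q hq => ihe.symm ▸ hl q hq, Prod.ext h' rfl⟩
  | zero => rfl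
  | sum d₁ d₂ ih₁ ih₂ => exact congrArg₂ _ ih₁ ih₂
  | diff d e ihd ihe =>
    ext ⟨γ, μ, s'⟩
    constructor
    · rintro ⟨γ₁, γ₂, _, s, _, h, he, ⟨⟩⟩
      exact ⟨γ₁, γ₂, s, ihd ▸ h, ihe ▸ he, rfl⟩
    · rintro ⟨γ₁, γ₂, s, h, he, h'⟩
      exact ⟨γ₁, γ₂, μ, s, s', ihd.symm ▸ h, ihe.symm ▸ he, Prod.ext h' rfl⟩

section

variable {V : P → IntSystem.{u}} {M N : Type u} [AddCommMonoid M] [AddCommMonoid N]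
  {Γ : List (Ty P)} {t : Tm} {σ τ : Ty P}

/-- Naturality of the interpretation in the monoid of weights. -/
theorem Der.push_sem {T : N → M → Prop} (hT : IsAdditive T) (d : Der Γ t σ) (θ : Env V N Γ) :
    push T (d.sem V N θ) = d.sem V M (θ.map T) := by
  induction d generalizing M N with
  | var x => rfl
  | lam d ih =>
    refine (push_lamRel T _).trans (congrArg lamRel ?_)
    rw [ih hT.idProd, Env.map_idProd_up hT.zero]
  | app d e ihd ihe =>
    exact (push_appRel hT _ _).trans (congrArg₂ appRel (ihd hT θ) (ihe hT θ))
  | zero => exact push_empty T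
  | sum d₁ d₂ ih₁ ih₂ => exact (push_union T _ _).trans (congrArg₂ _ (ih₁ hT θ) (ih₂ hT θ))
  | diff d e ihd ihe =>
    exact (push_diffRel hT _ _).trans (congrArg₂ diffRel (ihd hT θ) (ihe hT θ))

/-- Semantic form of β-reduction. -/
theorem Der.appRel_lamRel_sem (d : Der (τ :: Γ) t σ) (θ : Env V M Γ)
    (B : Set (M × (tySys V τ).State)) :
    appRel (lamRel (d.sem V _ (θ.up τ))) B = d.sem V M (Env.cons B θ) := by
  rw [← push_betaRel, d.push_sem (isAdditive_betaRel B), Env.map_betaRel_up]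

end

/-! ### Coherence: the interpretation depends on the judgement only -/

/-- External application: the weights of the function and of the argument are kept apart. -/
def extApp {M N X Y : Type u} [AddCommMonoid M] [AddCommMonoid N]
    (A : Set (M × (Multiset X × Y))) (B : Set (N × X)) : Set ((M × N) × Y) :=
  appRel (push (inlRel N) A) (push (inrRel M) B)

theorem mem_extApp {M N X Y : Type u} [AddCommMonoid M] [AddCommMonoid N]
    {A : Set (M × (Multiset X × Y))} {B : Set (N × X)} {m : M} {n : N} {s : Y} :
    ((m, n), s) ∈ extApp A B ↔ ∃ μ, (m, (μ, s)) ∈ A ∧ (n, μ) ∈ prom B := by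
  simp only [extApp, mem_appRel, mem_prom_push isAdditive_inrRel, Prod.exists, mem_inl_push]
  constructor
  · rintro ⟨m₁, n₁, m₂, n₂, μ, ⟨h, rfl⟩, ⟨n', h', ⟨⟩⟩, heq⟩
    simp only [Prod.mk_add_mk, add_zero, zero_add, Prod.mk.injEq] at heq
    obtain ⟨rfl, rfl⟩ := heq
    exact ⟨μ, h, h'⟩
  · rintro ⟨μ, h, h'⟩
    exact ⟨m, 0, 0, n, μ, ⟨h, rfl⟩, ⟨n, h', rfl⟩, by simp⟩

/-- Logical relation between weighted sets of states of two types. It is equality on each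
atom, holds trivially between types of different shapes, and is tested on arrow types by
external application to related arguments with arbitrary weights. Different shapes need no
condition, since a term which is applied has arrow types on both sides. -/
def LogRel (V : P → IntSystem.{u}) : (σ σ' : Ty P) → (M : Type u) → [AddCommMonoid M] →
    Set (M × (tySys V σ).State) → Set (M × (tySys V σ').State) → Prop
  | Ty.atom p, Ty.atom q, _, _, A, A' => p = q → HEq A A'
  | Ty.atom _, Ty.arrow _ _, _, _, _, _ => True
  | Ty.arrow _ _, Ty.atom _, _, _, _, _ => True
  | Ty.arrow τ σ, Ty.arrow τ' σ', M, _, A, A' =>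
    ∀ (N : Type u) [AddCommMonoid N] (C : Set (N × (tySys V τ).State))
      (C' : Set (N × (tySys V τ').State)),
      LogRel V τ τ' N C C' → LogRel V σ σ' (M × N) (extApp A C) (extApp A' C')

section LogicalRelation

variable {V : P → IntSystem.{u}} {M N : Type u} [AddCommMonoid M] [AddCommMonoid N]

theorem extApp_push {X Y K : Type u} [AddCommMonoid K] (T : N → M → Prop)
    (A : Set (N × (Multiset X × Y))) (B : Set (K × X)) :
    extApp (push T A) B = push (fun p q => T p.1 q.1 ∧ q.2 = p.2) (extApp A B) := by
  ext ⟨⟨m, k⟩, s⟩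
  rw [mem_extApp]
  constructor
  · rintro ⟨μ, ⟨n, h, hT⟩, hB⟩
    exact ⟨(n, k), mem_extApp.2 ⟨μ, h, hB⟩, hT, rfl⟩
  · rintro ⟨⟨n, _⟩, h, hT, rfl⟩
    obtain ⟨μ, h, hB⟩ := mem_extApp.1 h
    exact ⟨μ, ⟨n, h, hT⟩, hB⟩

theorem extApp_union {X Y : Type u} (A A' : Set (M × (Multiset X × Y))) (B : Set (N × X)) :
    extApp (A ∪ A') B = extApp A B ∪ extApp A' B := by
  ext ⟨⟨m, k⟩, s⟩
  simp only [mem_extApp, Set.mem_union, or_and_right, exists_or]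

theorem extApp_empty {X Y : Type u} (B : Set (N × X)) :
    extApp (∅ : Set (M × (Multiset X × Y))) B = ∅ := by
  ext ⟨⟨m, k⟩, s⟩
  simp [mem_extApp]

theorem appRel_eq_push_extApp {X Y : Type u} (A : Set (M × (Multiset X × Y)))
    (B : Set (M × X)) : appRel A B = push (fun p m => m = p.1 + p.2) (extApp A B) := by
  ext ⟨m, s⟩
  constructor
  · rintro ⟨m₁, m₂, μ, h, hB, rfl⟩
    exact ⟨(m₁, m₂), mem_extApp.2 ⟨μ, h, hB⟩, rfl⟩
  · rintro ⟨⟨m₁, m₂⟩, h, rfl⟩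
    obtain ⟨μ, h, hB⟩ := mem_extApp.1 h
    exact ⟨m₁, m₂, μ, h, hB, rfl⟩

/-- Weights for `(D A · B) C` in which the argument is the union of `C` and of a copy of `B`
with formal weights: the elements with exactly one formal weight are selected. -/
def oneRel (p : M × (Multiset M × N)) (q : M × N) : Prop :=
  ∃ b, p.2.1 = {b} ∧ q = (p.1 + b, p.2.2)

/-- Selection of the elements without formal weights. -/
def noneRel (p : M × (Multiset M × N)) (q : M × N) : Prop :=
  p.2.1 = 0 ∧ q = (p.1, p.2.2)

theorem isDerivation_oneRel : IsDerivation (noneRel (M := M) (N := N)) oneRel := by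
  refine ⟨⟨?_, ?_⟩, ?_, ?_⟩
  · rintro ⟨m, n⟩
    simp [noneRel]
  · rintro ⟨m, ν, n⟩ ⟨m', ν', n'⟩ ⟨a, b⟩
    simp only [noneRel, Prod.mk_add_mk, add_eq_zero]
    constructor
    · rintro ⟨⟨rfl, rfl⟩, h⟩
      exact ⟨_, _, ⟨rfl, rfl⟩, ⟨rfl, rfl⟩, h⟩
    · rintro ⟨_, _, ⟨rfl, rfl⟩, ⟨rfl, rfl⟩, h⟩
      exact ⟨⟨rfl, rfl⟩, h⟩
  · rintro ⟨m, n⟩ ⟨b, h, _⟩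
    exact Multiset.singleton_ne_zero b h.symm
  · rintro ⟨m, ν, n⟩ ⟨m', ν', n'⟩ q
    simp only [noneRel, oneRel, Prod.mk_add_mk]
    constructor
    · rintro ⟨b, h, rfl⟩
      obtain rfl | rfl := Multiset.le_singleton.1 (h ▸ Multiset.le_add_right ν ν' : ν ≤ {b})
      rotate_left
      · obtain rfl : ν' = 0 := add_eq_left.1 h
        exact Or.inl ⟨_, _, ⟨b, rfl, rfl⟩, ⟨rfl, rfl⟩, by simp [add_right_comm]⟩
      · obtain rfl : ν' = {b} := by simpa using h
        exact Or.inr ⟨_, _, ⟨rfl, rfl⟩, ⟨b, rfl, rfl⟩, by simp [add_assoc]⟩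
    · rintro (⟨_, _, ⟨b, rfl, rfl⟩, ⟨rfl, rfl⟩, rfl⟩ | ⟨_, _, ⟨rfl, rfl⟩, ⟨b, rfl, rfl⟩, rfl⟩)
      · exact ⟨b, by simp, by simp [add_right_comm]⟩
      · exact ⟨b, by simp, by simp [add_assoc]⟩

/-- By the Leibniz rule, a differential application under an application is obtained from a
single application by a change of weights. -/
theorem extApp_diffRel {X Y : Type u} (A : Set (M × (Multiset X × Y))) (B : Set (M × X))
    (C : Set (N × X)) :
    extApp (diffRel A B) C = push oneRel (extApp A
      (push (fun b (p : Multiset M × N) => p = ({b}, 0)) B ∪ push (inrRel (Multiset M)) C)) := by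
  have h₁ : push (oneRel (M := M) (N := N)) (push (inlRel (Multiset M × N)) A) = ∅ := by
    ext ⟨q, s⟩
    simp only [mem_push, inlRel, Set.mem_empty_iff_false, iff_false]
    rintro ⟨_, ⟨m, _, rfl⟩, b, h, _⟩
    exact Multiset.singleton_ne_zero b h.symm
  have h₂ : push (noneRel (M := M) (N := N)) (push (inlRel (Multiset M × N)) A) =
      push (inlRel N) A := by
    ext ⟨q, s⟩
    constructor
    · rintro ⟨_, ⟨m, h, rfl⟩, _, rfl⟩
      exact ⟨m, h, rfl⟩
    · rintro ⟨m, h, rfl⟩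
      exact ⟨_, ⟨m, h, rfl⟩, rfl, rfl⟩
  have h₃ : push (oneRel (M := M) (N := N)) (push (inrRel M)
      (push (fun b (p : Multiset M × N) => p = ({b}, 0)) B ∪ push (inrRel (Multiset M)) C)) =
      push (inlRel N) B := by
    ext ⟨q, s⟩
    constructor
    · rintro ⟨_, ⟨_, ⟨m, h, rfl⟩ | ⟨n, h, rfl⟩, rfl⟩, b, hb, rfl⟩
      · obtain rfl := Multiset.singleton_inj.1 hb
        exact ⟨m, h, by simp [inlRel]⟩
      · exact (Multiset.singleton_ne_zero b hb.symm).elim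
    · rintro ⟨m, h, rfl⟩
      exact ⟨_, ⟨_, Or.inl ⟨m, h, rfl⟩, rfl⟩, m, rfl, by simp⟩
  have h₄ : push (noneRel (M := M) (N := N)) (push (inrRel M)
      (push (fun b (p : Multiset M × N) => p = ({b}, 0)) B ∪ push (inrRel (Multiset M)) C)) =
      push (inrRel M) C := by
    ext ⟨q, s⟩
    constructor
    · rintro ⟨_, ⟨_, ⟨m, h, rfl⟩ | ⟨n, h, rfl⟩, rfl⟩, hb, rfl⟩
      · exact (Multiset.singleton_ne_zero m hb).elim
      · exact ⟨n, h, rfl⟩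
    · rintro ⟨n, h, rfl⟩
      exact ⟨_, ⟨_, Or.inr ⟨n, h, rfl⟩, rfl⟩, rfl, rfl⟩
  have h₀ : ∀ B : Set ((M × N) × X), appRel (∅ : Set ((M × N) × (Multiset X × Y))) B = ∅ := by
    intro B
    ext ⟨m, s⟩
    simp [mem_appRel]
  unfold extApp
  rw [isDerivation_oneRel.push_appRel, h₁, h₂, h₃, h₄, push_diffRel isAdditive_inlRel, h₀,
    Set.empty_union]

/-- The argument in which each state is its own weight recovers the function. -/
theorem mem_extApp_diagonal {X Y : Type u} {A : Set (M × (Multiset X × Y))} {m : M}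
    {μ : Multiset X} {s : Y} :
    ((m, μ), s) ∈ extApp A {p : Multiset X × X | p.1 = {p.2}} ↔ (m, (μ, s)) ∈ A := by
  have hprom : ∀ μ ν : Multiset X,
      (μ, ν) ∈ prom {p : Multiset X × X | p.1 = {p.2}} ↔ μ = ν := by
    intro μ ν
    induction ν using Multiset.induction_on generalizing μ with
    | empty => exact mem_prom_zero
    | cons s ν ih => simp [mem_prom_cons, ih]
  simp [mem_extApp, hprom]

theorem LogRel.of_eq {σ σ' : Ty P} {A B : Set (M × (tySys V σ).State)}
    {A' B' : Set (M × (tySys V σ').State)} (h : LogRel V σ σ' M A A') (hB : B = A)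
    (hB' : B' = A') : LogRel V σ σ' M B B' := by
  rwa [hB, hB']

/-- The logical relation is stable under all changes of weights, by relations which need not
respect sums. -/
theorem LogRel.push : ∀ {σ σ' : Ty P} {M N : Type u} [AddCommMonoid M] [AddCommMonoid N]
    (T : N → M → Prop) {A : Set (N × (tySys V σ).State)} {A' : Set (N × (tySys V σ').State)},
    LogRel V σ σ' N A A' → LogRel V σ σ' M (push T A) (push T A')
  | Ty.atom p, Ty.atom q, _, _, _, _, _, _, _, h => by
    rintro rfl
    rw [eq_of_heq (h rfl)]
  | Ty.atom _, Ty.arrow _ _, _, _, _, _, _, _, _, _ => trivial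
  | Ty.arrow _ _, Ty.atom _, _, _, _, _, _, _, _, _ => trivial
  | Ty.arrow τ σ, Ty.arrow τ' σ', _, _, _, _, T, A, A', h => by
    intro K _ C C' hC
    exact (LogRel.push _ (h K C C' hC)).of_eq (extApp_push T A C) (extApp_push T A' C')

theorem LogRel.union : ∀ {σ σ' : Ty P} {M : Type u} [AddCommMonoid M]
    {A B : Set (M × (tySys V σ).State)} {A' B' : Set (M × (tySys V σ').State)},
    LogRel V σ σ' M A A' → LogRel V σ σ' M B B' → LogRel V σ σ' M (A ∪ B) (A' ∪ B')
  | Ty.atom p, Ty.atom q, _, _, _, _, _, _, h, h' => by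
    rintro rfl
    rw [eq_of_heq (h rfl), eq_of_heq (h' rfl)]
  | Ty.atom _, Ty.arrow _ _, _, _, _, _, _, _, _, _ => trivial
  | Ty.arrow _ _, Ty.atom _, _, _, _, _, _, _, _, _ => trivial
  | Ty.arrow τ σ, Ty.arrow τ' σ', _, _, A, B, A', B', h, h' => by
    intro K _ C C' hC
    exact (LogRel.union (h K C C' hC) (h' K C C' hC)).of_eq (extApp_union A B C)
      (extApp_union A' B' C')

theorem LogRel.empty : ∀ (σ σ' : Ty P) (M : Type u) [AddCommMonoid M], LogRel V σ σ' M ∅ ∅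
  | Ty.atom p, Ty.atom q, _, _ => by
    rintro rfl
    rfl
  | Ty.atom _, Ty.arrow _ _, _, _ => trivial
  | Ty.arrow _ _, Ty.atom _, _, _ => trivial
  | Ty.arrow τ σ, Ty.arrow τ' σ', M, _ => by
    intro K _ C C' _
    exact (LogRel.empty σ σ' (M × K)).of_eq (extApp_empty C) (extApp_empty C')

/-- Between a type and itself, the logical relation is equality. -/
theorem logRel_self_iff : ∀ {σ : Ty P} {M : Type u} [AddCommMonoid M]
    {A A' : Set (M × (tySys V σ).State)}, LogRel V σ σ M A A' ↔ A = A'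
  | Ty.atom p, _, _, _, _ => ⟨fun h => eq_of_heq (h rfl), fun h _ => heq_of_eq h⟩
  | Ty.arrow τ σ, M, _, A, A' => by
    constructor
    · intro h
      -- The diagonal argument is related to itself, since the relation is equality on `τ`.
      have h' := logRel_self_iff.1 (h (Multiset (tySys V τ).State) {p | p.1 = {p.2}}
        {p | p.1 = {p.2}} (logRel_self_iff.2 rfl))
      ext ⟨m, μ, s⟩
      exact (mem_extApp_diagonal (A := A)).symm.trans
        ((Set.ext_iff.1 h' ((m, μ), s)).trans (mem_extApp_diagonal (A := A')))
    · rintro rfl N _ C C' hC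
      obtain rfl := logRel_self_iff.1 hC
      exact logRel_self_iff.2 rfl

theorem LogRel.appRel {σ σ' τ τ' : Ty P}
    {A : Set (M × (tySys V (τ.arrow σ)).State)} {A' : Set (M × (tySys V (τ'.arrow σ')).State)}
    {B : Set (M × (tySys V τ).State)} {B' : Set (M × (tySys V τ').State)}
    (hA : LogRel V (τ.arrow σ) (τ'.arrow σ') M A A') (hB : LogRel V τ τ' M B B') :
    LogRel V σ σ' M (DiffLambda.appRel A B) (DiffLambda.appRel A' B') := by
  exact (LogRel.push _ (hA M B B' hB)).of_eq (appRel_eq_push_extApp A B)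
    (appRel_eq_push_extApp A' B')

theorem LogRel.diffRel {σ σ' τ τ' : Ty P}
    {A : Set (M × (tySys V (τ.arrow σ)).State)} {A' : Set (M × (tySys V (τ'.arrow σ')).State)}
    {B : Set (M × (tySys V τ).State)} {B' : Set (M × (tySys V τ').State)}
    (hA : LogRel V (τ.arrow σ) (τ'.arrow σ') M A A') (hB : LogRel V τ τ' M B B') :
    LogRel V (τ.arrow σ) (τ'.arrow σ') M (DiffLambda.diffRel A B)
      (DiffLambda.diffRel A' B') := by
  intro N _ C C' hC
  exact (LogRel.push _ (hA _ _ _ (LogRel.union (LogRel.push _ hB) (LogRel.push _ hC)))).of_eq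
    (extApp_diffRel A B C) (extApp_diffRel A' B' C')

theorem Der.extApp_lamRel_sem {Γ : List (Ty P)} {t : Tm} {τ σ : Ty P} (d : Der (τ :: Γ) t σ)
    (θ : Env V M Γ) (C : Set (N × (tySys V τ).State)) :
    extApp (lamRel (d.sem V _ (θ.up τ))) C =
      d.sem V (M × N) (Env.cons (DiffLambda.push (inrRel M) C) (θ.map (inlRel N))) := by
  rw [extApp, push_lamRel, d.push_sem isAdditive_inlRel.idProd,
    Env.map_idProd_up isAdditive_inlRel.zero, d.appRel_lamRel_sem]

/-- Fundamental lemma of the logical relation, for two derivations with the same term. -/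
theorem Der.logRel_sem {Γ Γ' : List (Ty P)} {t : Tm} {σ σ' : Ty P} (d : Der Γ t σ)
    (d' : Der Γ' t σ') (θ : Env V M Γ) (θ' : Env V M Γ')
    (h : ∀ n τ τ' (x : Lookup Γ n τ) (x' : Lookup Γ' n τ'), LogRel V τ τ' M (θ x) (θ' x')) :
    LogRel V σ σ' M (d.sem V M θ) (d'.sem V M θ') := by
  induction d generalizing M Γ' σ' with
  | var x =>
    cases d' with
    | var x' => exact h _ _ _ x x'
  | lam d ih =>
    cases d' with
    | lam d' =>
      intro N _ C C' hC
      -- The test argument becomes the value of the bound variable, and all values are moved to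
      -- the common monoid of weights `M × N`.
      refine LogRel.of_eq (ih d' _ _ ?_) (d.extApp_lamRel_sem θ C) (d'.extApp_lamRel_sem θ' C')
      intro n ρ ρ' x x'
      cases x with
      | here =>
        cases x' with
        | here => exact hC.push _
      | there _ x =>
        cases x' with
        | there _ x' => exact (h _ _ _ x x').push _
  | app d e ihd ihe =>
    cases d' with
    | app d' e' => exact (ihd d' θ θ' h).appRel (ihe e' θ θ' h)
  | zero =>
    cases d' with
    | zero => exact LogRel.empty _ _ _
  | sum d₁ d₂ ih₁ ih₂ =>
    cases d' with
    | sum d₁' d₂' => exact (ih₁ d₁' θ θ' h).union (ih₂ d₂' θ θ' h)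
  | diff d e ihd ihe =>
    cases d' with
    | diff d' e' => exact (ihd d' θ θ' h).diffRel (ihe e' θ θ' h)

theorem Lookup.eq_and_heq {Γ : List (Ty P)} {n : ℕ} {τ τ' : Ty P} (x : Lookup Γ n τ)
    (x' : Lookup Γ n τ') : τ = τ' ∧ HEq x x' := by
  induction x with
  | here =>
    cases x' with
    | here => exact ⟨rfl, HEq.rfl⟩
  | there ρ x ih =>
    cases x' with
    | there _ x' =>
      obtain ⟨rfl, h⟩ := ih x'
      obtain rfl := eq_of_heq h
      exact ⟨rfl, HEq.rfl⟩

/-- Coherence: derivations of the same judgement have the same interpretation, although the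
types inside the derivations may differ. -/
theorem Der.sem_eq {Γ : List (Ty P)} {t : Tm} {σ : Ty P} (d d' : Der Γ t σ) (θ : Env V M Γ) :
    d.sem V M θ = d'.sem V M θ := by
  refine logRel_self_iff.1 (d.logRel_sem d' θ θ ?_)
  intro n τ τ' x x'
  obtain ⟨rfl, h⟩ := x.eq_and_heq x'
  obtain rfl := eq_of_heq h
  exact logRel_self_iff.2 rfl

end LogicalRelation

/-! ### Renaming, substitution and linear substitution -/

section Substitution

variable {V : P → IntSystem.{u}} {Γ Δ : List (Ty P)} {t u : Tm} {σ τ : Ty P}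

/-- Renaming of variables, where `r` checks the renaming against the two contexts. -/
theorem Der.exists_rename (V : P → IntSystem.{u}) (d : Der Γ t σ) (ρ : ℕ → ℕ)
    (r : ∀ ⦃n τ⦄, Lookup Γ n τ → Lookup Δ (ρ n) τ) :
    ∃ d' : Der Δ (t.rename ρ) σ, ∀ (M : Type u) [AddCommMonoid M] (θ : Env V M Δ),
      d'.sem V M θ = d.sem V M (fun _ _ x => θ (r x)) := by
  induction d generalizing Δ ρ with
  | var x => exact ⟨Der.var (r x), fun _ _ _ => rfl⟩
  | @lam Γ _ τ _ d ih =>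
    obtain ⟨d', h⟩ := ih (Δ := τ :: Δ) (Tm.upRen ρ) fun n ρ' x =>
      match n, x with
      | _, Lookup.here _ _ => Lookup.here Δ _
      | _, Lookup.there _ x => (r x).there _
    refine ⟨Der.lam d', fun M _ θ => congrArg lamRel ((h _ _).trans (congrArg _ ?_))⟩
    exact Env.ext_cons rfl fun _ _ _ => rfl
  | app d e ihd ihe =>
    obtain ⟨d', hd⟩ := ihd ρ r
    obtain ⟨e', he⟩ := ihe ρ r
    exact ⟨Der.app d' e', fun M _ θ => congrArg₂ appRel (hd M θ) (he M θ)⟩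
  | zero => exact ⟨Der.zero _ _, fun _ _ _ => rfl⟩
  | sum d e ihd ihe =>
    obtain ⟨d', hd⟩ := ihd ρ r
    obtain ⟨e', he⟩ := ihe ρ r
    exact ⟨Der.sum d' e', fun M _ θ => congrArg₂ (· ∪ ·) (hd M θ) (he M θ)⟩
  | diff d e ihd ihe =>
    obtain ⟨d', hd⟩ := ihd ρ r
    obtain ⟨e', he⟩ := ihe ρ r
    exact ⟨Der.diff d' e', fun M _ θ => congrArg₂ diffRel (hd M θ) (he M θ)⟩

theorem Der.exists_shift (V : P → IntSystem.{u}) (d : Der Γ t σ) (τ : Ty P) :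
    ∃ d' : Der (τ :: Γ) t.shift σ, ∀ (M : Type u) [AddCommMonoid M] (θ : Env V M (τ :: Γ)),
      d'.sem V M θ = d.sem V M (fun _ _ x => θ (x.there τ)) :=
  d.exists_rename V Nat.succ fun _ _ x => x.there τ

/-- Substitution lemma: substitution is interpreted by evaluation in the environment of the
interpretations of the substituted terms. -/
theorem Der.exists_subst (V : P → IntSystem.{u}) (d : Der Γ t σ) (ϑ : ℕ → Tm)
    (r : ∀ ⦃n τ⦄, Lookup Γ n τ → Der Δ (ϑ n) τ) :
    ∃ d' : Der Δ (t.subst ϑ) σ, ∀ (M : Type u) [AddCommMonoid M] (θ : Env V M Δ),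
      d'.sem V M θ = d.sem V M (fun _ _ x => (r x).sem V M θ) := by
  induction d generalizing Δ ϑ with
  | var x => exact ⟨r x, fun _ _ _ => rfl⟩
  | @lam Γ _ τ _ d ih =>
    choose s hs using fun {n ρ} (x : Lookup Γ n ρ) => (r x).exists_shift V τ
    obtain ⟨d', h⟩ := ih (Δ := τ :: Δ) (Tm.upSub ϑ) fun n ρ' x =>
      match n, x with
      | _, Lookup.here _ _ => Der.var (Lookup.here Δ _)
      | _, Lookup.there _ x => s x
    refine ⟨Der.lam d', fun M _ θ => congrArg lamRel ((h _ _).trans (congrArg _ ?_))⟩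
    exact Env.ext_cons rfl fun _ _ x =>
      (hs x _ (θ.up τ)).trans ((r x).push_sem isAdditive_inrRel θ).symm
  | app d e ihd ihe =>
    obtain ⟨d', hd⟩ := ihd ϑ r
    obtain ⟨e', he⟩ := ihe ϑ r
    exact ⟨Der.app d' e', fun M _ θ => congrArg₂ appRel (hd M θ) (he M θ)⟩
  | zero => exact ⟨Der.zero _ _, fun _ _ _ => rfl⟩
  | sum d e ihd ihe =>
    obtain ⟨d', hd⟩ := ihd ϑ r
    obtain ⟨e', he⟩ := ihe ϑ r
    exact ⟨Der.sum d' e', fun M _ θ => congrArg₂ (· ∪ ·) (hd M θ) (he M θ)⟩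
  | diff d e ihd ihe =>
    obtain ⟨d', hd⟩ := ihd ϑ r
    obtain ⟨e', he⟩ := ihe ϑ r
    exact ⟨Der.diff d' e', fun M _ θ => congrArg₂ diffRel (hd M θ) (he M θ)⟩

theorem Der.exists_inst (V : P → IntSystem.{u}) (d : Der (τ :: Γ) t σ) (e : Der Γ u τ) :
    ∃ d' : Der Γ (Tm.inst u t) σ, ∀ (M : Type u) [AddCommMonoid M] (θ : Env V M Γ),
      d'.sem V M θ = d.sem V M (Env.cons (e.sem V M θ) θ) := by
  obtain ⟨d', h⟩ := d.exists_subst V (Δ := Γ) (fun n => match n with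
    | 0 => u
    | m + 1 => Tm.var m) fun n ρ x =>
      match n, x with
      | _, Lookup.here _ _ => e
      | _, Lookup.there _ x => Der.var x
  refine ⟨d', fun M _ θ => (h M θ).trans (congrArg _ ?_)⟩
  exact Env.ext_cons rfl fun _ _ _ => rfl

/-- The linear substitution is interpreted by any derivation of the weights that sends the value
of `x` to the interpretation of `u` and is zero on the values of the other variables. -/
theorem Der.exists_linSubst (V : P → IntSystem.{u}) (d : Der Γ t σ) {k : ℕ} (x : Lookup Γ k τ)
    (e : Der Γ u τ) :
    ∃ d' : Der Γ (Tm.linSubst k u t) σ, ∀ (M N : Type u) [AddCommMonoid M] [AddCommMonoid N]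
      (T₀ T₁ : N → M → Prop) (_ : IsDerivation T₀ T₁) (θ : Env V N Γ)
      (_ : push T₁ (θ x) = e.sem V M (θ.map T₀))
      (_ : ∀ n ρ (y : Lookup Γ n ρ), n ≠ k → push T₁ (θ y) = ∅),
      d'.sem V M (θ.map T₀) = push T₁ (d.sem V N θ) := by
  induction d generalizing u τ k with
  | @var Γ n ρ y =>
    by_cases hn : n = k
    · subst hn
      obtain ⟨rfl, hy⟩ := x.eq_and_heq y
      obtain rfl := eq_of_heq hy
      rw [Tm.linSubst, if_pos rfl]
      exact ⟨e, fun M N _ _ T₀ T₁ hT θ h h' => h.symm⟩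
    · rw [Tm.linSubst, if_neg hn]
      exact ⟨Der.zero _ _, fun M N _ _ T₀ T₁ hT θ h h' => (h' n ρ y hn).symm⟩
  | @lam Γ _ ρ _ d ih =>
    obtain ⟨e', he⟩ := e.exists_shift V ρ
    obtain ⟨d', hd⟩ := ih (x.there ρ) e'
    -- Under a binder, `T₁` leaves the fresh weights alone. It is zero on the bound variable, whose
    -- weight in `N` is `0`.
    refine ⟨Der.lam d', fun M N _ _ T₀ T₁ hT θ h h' => ?_⟩
    refine Eq.trans (congrArg lamRel ?_) (push_lamRel T₁ _).symm
    rw [← Env.map_idProd_up hT.additive.zero]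
    refine hd _ _ _ _ hT.idProd _ ?_ ?_
    · rw [he]
      refine (push_idProd_inrRel T₁ (θ x)).trans ?_
      rw [h, e.push_sem isAdditive_inrRel]
      refine congrArg _ ?_
      funext n ρ' y
      exact (push_idProd_inrRel T₀ (θ y)).symm
    · intro n ρ' y hn
      cases y with
      | here =>
        ext ⟨⟨μ, m⟩, s⟩
        simp only [Set.mem_empty_iff_false, iff_false]
        rintro ⟨p, hp, _, hm⟩
        obtain rfl : p = ({s}, 0) := hp
        exact hT.zero m hm
      | there _ y =>
        refine (push_idProd_inrRel T₁ (θ y)).trans ?_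
        rw [h' _ _ y (fun h => hn (congrArg _ h)), push_empty]
  | app d e' ihd ihe =>
    obtain ⟨d₁, hd⟩ := ihd x e
    obtain ⟨e₁, he⟩ := ihe x e
    refine ⟨Der.sum (Der.app d₁ e') (Der.app (Der.diff d e₁) e'),
      fun M N _ _ T₀ T₁ hT θ h h' => Eq.trans ?_ (hT.push_appRel _ _).symm⟩
    have hd₁ := hd M N T₀ T₁ hT θ h h'
    have he₁ := he M N T₀ T₁ hT θ h h'
    have hd₀ := (d.push_sem hT.additive θ).symm
    have he₀ := (e'.push_sem hT.additive θ).symm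
    exact congrArg₂ (· ∪ ·) (congrArg₂ appRel hd₁ he₀)
      (congrArg₂ appRel (congrArg₂ diffRel hd₀ he₁) he₀)
  | zero => exact ⟨Der.zero _ _, fun M N _ _ T₀ T₁ hT θ h h' => (push_empty T₁).symm⟩
  | sum d₁ d₂ ih₁ ih₂ =>
    obtain ⟨d₁', h₁⟩ := ih₁ x e
    obtain ⟨d₂', h₂⟩ := ih₂ x e
    refine ⟨Der.sum d₁' d₂', fun M N _ _ T₀ T₁ hT θ h h' => ?_⟩
    exact (congrArg₂ (· ∪ ·) (h₁ M N T₀ T₁ hT θ h h') (h₂ M N T₀ T₁ hT θ h h')).trans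
      (push_union T₁ _ _).symm
  | diff d e' ihd ihe =>
    obtain ⟨d₁, hd⟩ := ihd x e
    obtain ⟨e₁, he⟩ := ihe x e
    refine ⟨Der.sum (Der.diff d₁ e') (Der.diff d e₁),
      fun M N _ _ T₀ T₁ hT θ h h' => Eq.trans ?_ (hT.push_diffRel _ _).symm⟩
    have hd₁ := hd M N T₀ T₁ hT θ h h'
    have he₁ := he M N T₀ T₁ hT θ h h'
    have hd₀ := (d.push_sem hT.additive θ).symm
    have he₀ := (e'.push_sem hT.additive θ).symm
    exact congrArg₂ (· ∪ ·) (congrArg₂ diffRel hd₁ he₀) (congrArg₂ diffRel hd₀ he₁)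

end Substitution

/-! ### Reduction -/

/-- Replacement of exactly one generic element in a weight by a weighted element of `B`. This is a
derivation over the identity. -/
def linRel {M X : Type u} [AddCommMonoid M] (B : Set (M × X)) (p q : Multiset X × M) : Prop :=
  ∃ s n, p.1 = q.1 + {s} ∧ (n, s) ∈ B ∧ q.2 = p.2 + n

theorem isDerivation_linRel {M X : Type u} [AddCommMonoid M] (B : Set (M × X)) :
    IsDerivation Eq (linRel B) := by
  refine ⟨⟨fun m => eq_comm, fun n n' m => ?_⟩, ?_, ?_⟩
  · constructor
    · rintro rfl
      exact ⟨n, n', rfl, rfl, rfl⟩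
    · rintro ⟨_, _, rfl, rfl, rfl⟩
      rfl
  · rintro ⟨μ, m⟩ ⟨s, n, h, -⟩
    have := congrArg Multiset.card h
    simp at this
  · rintro ⟨μ, m⟩ ⟨μ', m'⟩ ⟨ν, k⟩
    constructor
    · rintro ⟨s, n, h, hB, rfl⟩
      replace h : μ + μ' = ν + {s} := h
      have hs : s ∈ μ + μ' := by simp [h]
      obtain hs | hs := Multiset.mem_add.1 hs
      · obtain ⟨μ₁, rfl⟩ := Multiset.exists_cons_of_mem hs
        refine Or.inl ⟨(μ₁, m + n), (μ', m'), ⟨s, n, ?_, hB, rfl⟩, rfl, ?_⟩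
        · rw [add_comm, Multiset.singleton_add]
        · obtain rfl : μ₁ + μ' = ν := by
            rw [add_comm ν, Multiset.singleton_add, Multiset.cons_add] at h
            exact (Multiset.cons_inj_right s).1 h
          exact Prod.ext rfl (add_right_comm m m' n)
      · obtain ⟨μ₁, rfl⟩ := Multiset.exists_cons_of_mem hs
        refine Or.inr ⟨(μ, m), (μ₁, m' + n), rfl, ⟨s, n, ?_, hB, rfl⟩, ?_⟩
        · rw [add_comm, Multiset.singleton_add]
        · obtain rfl : μ + μ₁ = ν := by
            rw [add_comm ν, Multiset.singleton_add, Multiset.add_cons] at h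
            exact (Multiset.cons_inj_right s).1 h
          exact Prod.ext rfl (add_assoc m m' n)
    · rintro (⟨⟨μ₁, m₁⟩, _, ⟨s, n, h, hB, h'⟩, rfl, heq⟩ |
        ⟨_, ⟨μ₁, m₁⟩, rfl, ⟨s, n, h, hB, h'⟩, heq⟩)
      · obtain ⟨rfl, rfl⟩ := Prod.mk.inj heq
        dsimp only at h h'
        subst h h'
        exact ⟨s, n, add_right_comm _ _ _, hB, add_right_comm _ _ _⟩
      · obtain ⟨rfl, rfl⟩ := Prod.mk.inj heq
        dsimp only at h h'
        subst h h'
        exact ⟨s, n, (add_assoc _ _ _).symm, hB, (add_assoc _ _ _).symm⟩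

theorem lamRel_push_linRel {M X Y : Type u} [AddCommMonoid M] (B : Set (M × X))
    (A : Set ((Multiset X × M) × Y)) :
    lamRel (push (linRel B) A) = diffRel (lamRel A) B := by
  ext ⟨m, μ, s'⟩
  constructor
  · rintro ⟨⟨_, m₁⟩, h, s, n, rfl, hB, hm⟩
    exact ⟨m₁, n, s, h, hB, hm⟩
  · rintro ⟨m₁, n, s, h, hB, hm⟩
    refine ⟨(μ + {s}, m₁), ?_, s, n, rfl, hB, hm⟩
    exact h

theorem push_linRel_generic {M X : Type u} [AddCommMonoid M] (B : Set (M × X)) :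
    push (linRel B) (generic M X) = push (inrRel (Multiset X)) B := by
  ext ⟨⟨μ, m⟩, s⟩
  rw [mem_inr_push]
  constructor
  · rintro ⟨p, hp, s', n, h, hB, h'⟩
    obtain rfl : p = ({s}, 0) := hp
    dsimp only at h h'
    obtain rfl : μ = 0 := by
      have := congrArg Multiset.card h
      simpa using this
    obtain rfl : s = s' := by simpa using h
    rw [zero_add] at h'
    exact ⟨h' ▸ hB, rfl⟩
  · rintro ⟨h, rfl⟩
    exact ⟨({s}, 0), rfl, s, m, (zero_add _).symm, h, (zero_add m).symm⟩

theorem push_linRel_inrRel {M X Y : Type u} [AddCommMonoid M] (B : Set (M × X))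
    (A : Set (M × Y)) : push (linRel B) (push (inrRel (Multiset X)) A) = ∅ := by
  ext ⟨⟨μ, m⟩, s⟩
  simp only [Set.mem_empty_iff_false, iff_false]
  rintro ⟨_, ⟨k, _, rfl⟩, s', n, h, -⟩
  have := congrArg Multiset.card h
  simp at this

theorem push_eq {M X : Type u} (A : Set (M × X)) : push Eq A = A := by
  ext ⟨m, s⟩
  simp [mem_push]

section Reduction

variable (V : P → IntSystem.{u}) {Γ : List (Ty P)} {t u : Tm} {σ : Ty P}

/-- β-reduction preserves typing and interpretation. -/
theorem Der.exists_inst_interp_eq (d : Der Γ (Tm.app (Tm.lam t) u) σ) :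
    ∃ d' : Der Γ (Tm.inst u t) σ, d.interp V = d'.interp V := by
  cases d with
  | app d e =>
    cases d with
    | lam d =>
      obtain ⟨d', h⟩ := d.exists_inst V e
      refine ⟨d', ?_⟩
      rw [Der.interp_eq_sem, Der.interp_eq_sem, h]
      exact d.appRel_lamRel_sem _ _

/-- Differential reduction preserves typing and interpretation. -/
theorem Der.exists_linSubst_interp_eq (d : Der Γ (Tm.diff (Tm.lam t) u) σ) :
    ∃ d' : Der Γ (Tm.lam (Tm.linSubst 0 (Tm.shift u) t)) σ, d.interp V = d'.interp V := by
  cases d with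
  | @diff _ _ _ τ σ d e =>
    cases d with
    | lam d =>
      obtain ⟨e', he⟩ := e.exists_shift V τ
      obtain ⟨d', h⟩ := d.exists_linSubst V (Lookup.here Γ τ) e'
      refine ⟨Der.lam d', ?_⟩
      rw [Der.interp_eq_sem, Der.interp_eq_sem]
      set θ := genEnv V Γ
      have hmap : (θ.up τ).map Eq = θ.up τ := by
        funext n ρ x
        exact push_eq _
      have key := h _ _ Eq _ (isDerivation_linRel (e.sem V _ θ)) (θ.up τ)
        (by
          rw [he, hmap]
          exact (push_linRel_generic _).trans (e.push_sem isAdditive_inrRel θ))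
        (by
          intro n ρ y hn
          cases y with
          | here => exact (hn rfl).elim
          | there _ y => exact push_linRel_inrRel _ _)
      rw [hmap] at key
      exact (lamRel_push_linRel _ _).symm.trans (congrArg lamRel key.symm)

/-- Coherence of the interpretation in the weights `!Γ`. -/
theorem Der.interp_eq_interp (d d' : Der Γ t σ) : d.interp V = d'.interp V := by
  rw [d.interp_eq_sem, d'.interp_eq_sem, d.sem_eq d']

end Reduction

end DiffLambda

theorem mainTheorem8 {P : Type v} (V : P → DiffLambda.IntSystem.{u}) :
    (∀ (Γ : List (DiffLambda.Ty P)) (t : DiffLambda.Tm) (σ : DiffLambda.Ty P)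
      (d : DiffLambda.Der Γ t σ),
      DiffLambda.IsSimulation (DiffLambda.ctxSys V Γ) (DiffLambda.tySys V σ) (d.interp V)) ∧
    (∀ (Γ : List (DiffLambda.Ty P)) (t u : DiffLambda.Tm) (σ : DiffLambda.Ty P)
      (d : DiffLambda.Der Γ (DiffLambda.Tm.app (DiffLambda.Tm.lam t) u) σ),
      Nonempty (DiffLambda.Der Γ (DiffLambda.Tm.inst u t) σ) ∧
      ∀ d' : DiffLambda.Der Γ (DiffLambda.Tm.inst u t) σ, d.interp V = d'.interp V) ∧
    (∀ (Γ : List (DiffLambda.Ty P)) (t u : DiffLambda.Tm) (σ : DiffLambda.Ty P)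
      (d : DiffLambda.Der Γ (DiffLambda.Tm.diff (DiffLambda.Tm.lam t) u) σ),
      Nonempty (DiffLambda.Der Γ
        (DiffLambda.Tm.lam (DiffLambda.Tm.linSubst 0 (DiffLambda.Tm.shift u) t)) σ) ∧
      ∀ d' : DiffLambda.Der Γ
        (DiffLambda.Tm.lam (DiffLambda.Tm.linSubst 0 (DiffLambda.Tm.shift u) t)) σ,
        d.interp V = d'.interp V) := by
  refine ⟨fun Γ t σ d => d.isSimulation_interp V, fun Γ t u σ d => ?_, fun Γ t u σ d => ?_⟩
  · obtain ⟨d₀, h⟩ := d.exists_inst_interp_eq V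
    exact ⟨⟨d₀⟩, fun d' => h.trans (d₀.interp_eq_interp V d')⟩
  · obtain ⟨d₀, h⟩ := d.exists_linSubst_interp_eq V
    exact ⟨⟨d₀⟩, fun d' => h.trans (d₀.interp_eq_interp V d')⟩
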